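/- **Ward identities for the twisted Gaussian measure.** Let $P$ be an irreducible transition matrix on $[n]=\{1,\dots,n\}$ with stationary distribution $\nu$, let $\Pi=\mathrm{diag}(\nu)$, let $Q=\Pi(P-I)$ be the normalized Laplacian, and let $(X_t)_{t\ge0}$ be the (right-continuous) continuous-time Markov chain on $[n]$ with rate matrix $Q$. The reversed chain has transition matrix $P^*=\Pi^{-1}P^{T}\Pi$, i.e. its rate matrix is $\Pi(P^*-I)=Q^{T}$. For $i\in[n]$ and $l\in\mathbb R_+^n=[0,\infty)^n$, write $\mathbb E_{i,l}$ for the expectation when $X_0=i$ and the local time starts from $l$, so that $\mathcal L_t^j=l_j+\int_0^t\mathbf 1\{X_s=j\}\,ds$; write $\mathbb E^*_{i,l}$ for the same with the reversed chain. For $\phi=u+\mathrm i v\in\mathbb C^n$ put $\phi\bar\phi=(|\phi_j|^2)_{j}$, $\langle\phi,Q\bar\phi\rangle=\sum_{j,k}Q_{jk}\phi_j\bar\phi_k$, $\frac{\partial}{\partial\phi_i}=\frac12\big(\frac{\partial}{\partial u_i}-\mathrm i\frac{\partial}{\partial v_i}\big)$, $\frac{\partial}{\partial\bar\phi_i}=\frac12\big(\frac{\partial}{\partial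 u_i}+\mathrm i\frac{\partial}{\partial v_i}\big)$, and $$[F]_\mu=\int_{\mathbb R^{2n}}F(\phi)\,\pi^{-n}e^{\langle\phi,Q\bar\phi\rangle}\,du\,dv .$$ Let $f:[n]\times\mathbb R_+^n\to\mathbb C$ be such that for each $i$ the function $f(i,\cdot)$ is $C^\infty$ on $\mathbb R_+^n$ and each of its derivatives (of every order $k\ge0$) decays at infinity faster than every power of $\|l\|^{-1}$. Let $g:\mathbb C^n\to\mathbb C$ be $C^\infty$ (in the real sense) such that for each $k\ge0$ there are $b_k,d_k>0$ with $\|g^{(k)}(\phi)\|\le b_k(1+\|\phi\|)^{d_k}$ for all $\phi$. Then $$\sum_{i}\big[\phi_i\,g(\phi)\,f(i,\phi\bar\phi)\big]_\mu=\sum_i\Big[\frac{\partial g}{\partial\bar\phi_i}(\phi)\int_0^\infty\mathbb E_{i,\phi\bar\phi}f(X_t,\mathcal L_t)\,dt\Big]_\mu$$ and $$\sum_{i}\big[\bar\phi_i\,g(\phi)\,f(i,\phi\bar\phi)\big]_\mu=\sum_i\Big[\frac{\partial g}{\partial\phi_i}(\phi)\int_0^\infty\mathbb E^*_{i,\phi\bar\phi}f(X_t,\mathcal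 L_t)\,dt\Big]_\mu,$$ where all expectations, time integrals and brackets $[\cdot]_\mu$ that occur converge absolutely. -/

import Mathlib

open MeasureTheory

noncomputable section

namespace Ward

/-- `st` is a stationary probability distribution of the transition matrix `P`. -/
structure IsStationary {n : ℕ} (P : Matrix (Fin n) (Fin n) ℝ) (st : Fin n → ℝ) : Prop where
  nonneg : ∀ i, 0 ≤ st i
  sum_eq_one : ∑ i, st i = 1
  invariant : ∀ j, ∑ i, st i * P i j = st j

/-- The normalized Laplacian `Q = Π (P - I)`, with `Π = diag(st)`. -/
def laplacian {n : ℕ} (P : Matrix (Fin n) (Fin n) ℝ) (st : Fin n → ℝ) :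
    Matrix (Fin n) (Fin n) ℝ :=
  Matrix.diagonal st * (P - 1)

/-- The transition matrix `P* = Π⁻¹ Pᵀ Π` of the time reversal. -/
def timeReversal {n : ℕ} (P : Matrix (Fin n) (Fin n) ℝ) (st : Fin n → ℝ) :
    Matrix (Fin n) (Fin n) ℝ :=
  Matrix.diagonal (fun i => (st i)⁻¹) * P.transpose * Matrix.diagonal st

/-- `X`, under the probability measures `ℙ i` (`i` being the initial state), is a continuous-time
Markov chain on `Fin n` with rate matrix `Q`: the paths are right-continuous, and under `ℙ i` the
finite-dimensional distributions are those of the Markov process that starts at `i` and has the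
transition semigroup `exp (t Q)`. Only times `t ≥ 0` matter. -/
structure IsMarkovChain {n : ℕ} {Ω : Type*} [MeasurableSpace Ω] (Q : Matrix (Fin n) (Fin n) ℝ)
    (X : ℝ → Ω → Fin n) (ℙ : Fin n → Measure Ω) : Prop where
  isProbabilityMeasure : ∀ i, IsProbabilityMeasure (ℙ i)
  measurable : ∀ t, 0 ≤ t → Measurable (X t)
  rightContinuous : ∀ ω t, 0 ≤ t → ContinuousWithinAt (fun s => X s ω) (Set.Ici t) t
  finiteDimensional : ∀ (i : Fin n) (k : ℕ) (t : Fin (k + 1) → ℝ) (x : Fin (k + 1) → Fin n),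
    Monotone t → t 0 = 0 →
      ℙ i {ω | ∀ m, X (t m) ω = x m} =
        ENNReal.ofReal ((if x 0 = i then 1 else 0) *
          ∏ m : Fin k,
            NormedSpace.exp ((t m.succ - t m.castSucc) • Q) (x m.castSucc) (x m.succ))

/-- The local time `j ↦ ∫₀ᵗ 1{X_s = j} ds`. -/
def localTime {n : ℕ} {Ω : Type*} (X : ℝ → Ω → Fin n) (t : ℝ) (ω : Ω) : Fin n → ℝ :=
  fun j => ∫ s in (0 : ℝ)..t, if X s ω = j then 1 else 0

/-- The random variable `f (X_t, 𝓛_t)`, where the local time starts from the value `l`. -/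
def observable {n : ℕ} {Ω : Type*} (X : ℝ → Ω → Fin n) (f : Fin n → (Fin n → ℝ) → ℂ)
    (l : Fin n → ℝ) (t : ℝ) (ω : Ω) : ℂ :=
  f (X t ω) (l + localTime X t ω)

/-- The expectation `𝔼_{i,l} f (X_t, 𝓛_t)`: the chain starts at `i` and the local time at `l`. -/
def expect {n : ℕ} {Ω : Type*} [MeasurableSpace Ω] (X : ℝ → Ω → Fin n) (ℙ : Fin n → Measure Ω)
    (f : Fin n → (Fin n → ℝ) → ℂ) (i : Fin n) (l : Fin n → ℝ) (t : ℝ) : ℂ :=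
  ∫ ω, observable X f l t ω ∂(ℙ i)

/-- The time integral `∫₀^∞ 𝔼_{i,l} f (X_t, 𝓛_t) dt`. -/
def potential {n : ℕ} {Ω : Type*} [MeasurableSpace Ω] (X : ℝ → Ω → Fin n) (ℙ : Fin n → Measure Ω)
    (f : Fin n → (Fin n → ℝ) → ℂ) (i : Fin n) (l : Fin n → ℝ) : ℂ :=
  ∫ t in Set.Ioi (0 : ℝ), expect X ℙ f i l t

/-- A function on the closed orthant `ℝ₊ⁿ` (values elsewhere are irrelevant) that is smooth and all
of whose derivatives decay faster than every power of the norm. -/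
def PropertyF {n : ℕ} (u : (Fin n → ℝ) → ℂ) : Prop :=
  ContDiffOn ℝ (⊤ : ℕ∞) u (Set.Ici 0) ∧
    ∀ k d : ℕ, ∃ C : ℝ, ∀ l ∈ Set.Ici (0 : Fin n → ℝ),
      (1 + ‖l‖) ^ d * ‖iteratedFDerivWithin ℝ k u (Set.Ici 0) l‖ ≤ C

/-- A function on `ℂⁿ` that is smooth in the real sense and all of whose derivatives are bounded by
a constant times some power of `1 + ‖φ‖`. -/
def PropertyG {n : ℕ} (g : (Fin n → ℂ) → ℂ) : Prop :=
  Function.HasTemperateGrowth g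

/-- `∂/∂φᵢ = (∂/∂uᵢ - i ∂/∂vᵢ) / 2`, where `φ = u + i v`. -/
def wirtinger {n : ℕ} (i : Fin n) (g : (Fin n → ℂ) → ℂ) (φ : Fin n → ℂ) : ℂ :=
  (1 / 2) * (fderiv ℝ g φ (Pi.single i 1) - Complex.I * fderiv ℝ g φ (Pi.single i Complex.I))

/-- `∂/∂φ̄ᵢ = (∂/∂uᵢ + i ∂/∂vᵢ) / 2`, where `φ = u + i v`. -/
def wirtingerBar {n : ℕ} (i : Fin n) (g : (Fin n → ℂ) → ℂ) (φ : Fin n → ℂ) : ℂ :=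
  (1 / 2) * (fderiv ℝ g φ (Pi.single i 1) + Complex.I * fderiv ℝ g φ (Pi.single i Complex.I))

/-- The vector `φ φ̄ = (|φᵢ|²)ᵢ` in `ℝ₊ⁿ`. -/
def absSq {n : ℕ} (φ : Fin n → ℂ) : Fin n → ℝ :=
  fun i => Complex.normSq (φ i)

/-- The density `π⁻ⁿ exp ⟨φ, Q φ̄⟩` of the twisted Gaussian measure `μ` with respect to `du dv`. -/
def density {n : ℕ} (Q : Matrix (Fin n) (Fin n) ℝ) (φ : Fin n → ℂ) : ℂ :=
  ((Real.pi : ℂ) ^ n)⁻¹ *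
    Complex.exp (∑ i, ∑ j, φ i * ((Q i j : ℂ) * (starRingEnd ℂ) (φ j)))

/-- The integral `[F]_μ` of `F` against the twisted Gaussian measure. -/
def bracket {n : ℕ} (Q : Matrix (Fin n) (Fin n) ℝ) (F : (Fin n → ℂ) → ℂ) : ℂ :=
  ∫ φ, F φ * density Q φ

/-- The integral `[F]_μ` converges absolutely. -/
def BracketIntegrable {n : ℕ} (Q : Matrix (Fin n) (Fin n) ℝ) (F : (Fin n → ℂ) → ℂ) : Prop :=
  Integrable (fun φ => F φ * density Q φ)

/-- For initial data in the orthant, the expectations `𝔼_{i,l} f (X_t, 𝓛_t)` and their time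
integral converge absolutely. -/
def PotentialConverges {n : ℕ} {Ω : Type*} [MeasurableSpace Ω] (X : ℝ → Ω → Fin n)
    (ℙ : Fin n → Measure Ω) (f : Fin n → (Fin n → ℝ) → ℂ) : Prop :=
  ∀ (i : Fin n), ∀ l ∈ Set.Ici (0 : Fin n → ℝ),
    (∀ t, 0 ≤ t → Integrable (observable X f l t) (ℙ i)) ∧
      IntegrableOn (expect X ℙ f i l) (Set.Ioi 0)

end Ward

end

/-! Put (Av)_i = ∂_i v_i + Σ_j Q_ij v_j (`genApply`), the generator of the pair formed by the state
and the local time. On functions of φφ̄ the operator ∂/∂φ̄_i acts as φ_i ∂_i, and it multiplies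
exp⟨φ,Qφ̄⟩ by Σ_j φ_j Q_ji. Integration by parts and an exchange of indices therefore give Σ_i
[∂g/∂φ̄_i · v_i] = -Σ_i [φ_i g (Av)_i] (`sum_bracket_wirtingerBar_mul`). If v is the potential of f
then formally Av = -f, and this is the first identity.

The potential itself is never differentiated. It is replaced by Riemann sums over a time grid
(`gridPotential`), which are finite combinations of translates of f, so that derivatives in l pass
through termwise. Applied to them, A telescopes up to a vanishing error and tends to -f
(`SmoothFamily.tendsto_genApply_gridPotential`). Dominated convergence then needs only bounds
uniform in the mesh and a pointwise limit of the sums (`SmoothFamily.ward_of_tendsto`).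
Right-continuity and the finite-dimensional distributions identify that limit as the potential
(`IsMarkovChain.potentialConverges_and_tendsto`).

All convergence comes from one fact: 1 + Σ_j l_j grows by exactly the elapsed time along every path,
so rapid decay of f in l is also decay in time. The density contributes only the bound |density| ≤
1. It is invariant under adding a constant vector to φ, so integrability in φ must come from f.

Complex conjugation of the coordinates exchanges Q with its transpose and ∂/∂φ̄_i with ∂/∂φ_i, which
turns the first identity into the second. -/

noncomputable section

namespace Ward

open Filter Topology ComplexConjugate

variable {n : ℕ}

/-! ### Generators and time reversal -/

/-- Rate matrices that leave the counting measure invariant. -/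
structure IsGenerator (Q : Matrix (Fin n) (Fin n) ℝ) : Prop where
  offDiag_nonneg : ∀ i j, i ≠ j → 0 ≤ Q i j
  row_sum : ∀ i, ∑ j, Q i j = 0
  col_sum : ∀ j, ∑ i, Q i j = 0

lemma laplacian_apply (P : Matrix (Fin n) (Fin n) ℝ) (st : Fin n → ℝ) (i j : Fin n) :
    laplacian P st i j = st i * (P i j - if i = j then 1 else 0) := by
  simp [laplacian, Matrix.diagonal_mul, Matrix.one_apply]

lemma IsGenerator.laplacian {P : Matrix (Fin n) (Fin n) ℝ} {st : Fin n → ℝ}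
    (hP : P ∈ Matrix.rowStochastic ℝ (Fin n)) (hst : IsStationary P st) :
    IsGenerator (laplacian P st) where
  offDiag_nonneg i j hij := by
    rw [laplacian_apply, if_neg hij, sub_zero]
    exact mul_nonneg (hst.nonneg i) (Matrix.nonneg_of_mem_rowStochastic hP)
  row_sum i := by
    simp only [laplacian_apply]
    rw [← Finset.mul_sum, Finset.sum_sub_distrib, Matrix.sum_row_of_mem_rowStochastic hP]
    simp
  col_sum j := by
    simp only [laplacian_apply, mul_sub, Finset.sum_sub_distrib, hst.invariant]
    simp

lemma IsGenerator.transpose {Q : Matrix (Fin n) (Fin n) ℝ} (hQ : IsGenerator Q) :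
    IsGenerator Q.transpose where
  offDiag_nonneg i j hij := hQ.offDiag_nonneg j i hij.symm
  row_sum := hQ.col_sum
  col_sum := hQ.row_sum

lemma laplacian_timeReversal {P : Matrix (Fin n) (Fin n) ℝ} {st : Fin n → ℝ}
    (hP : P ∈ Matrix.rowStochastic ℝ (Fin n)) (hst : IsStationary P st) :
    laplacian (timeReversal P st) st = (laplacian P st).transpose := by
  ext i j
  have ht : timeReversal P st i j = (st i)⁻¹ * P j i * st j := by
    simp [timeReversal, Matrix.mul_diagonal, Matrix.diagonal_mul]
  rw [Matrix.transpose_apply, laplacian_apply, laplacian_apply, ht]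
  by_cases hi : st i = 0
  -- At a null state `(st i)⁻¹` is 0, so the definition of the reversal says nothing. Stationarity
  -- makes every flow `st k * P k i` into `i` vanish, hence both sides are 0.
  · have h0 : ∀ k, st k * P k i = 0 := by
      have := (Finset.sum_eq_zero_iff_of_nonneg (s := Finset.univ) (f := fun k => st k * P k i)
        (fun k _ => mul_nonneg (hst.nonneg k) (Matrix.nonneg_of_mem_rowStochastic hP))).1
        (by rw [hst.invariant, hi])
      exact fun k => this k (Finset.mem_univ k)
    by_cases hij : j = i
    · simp [hij, hi]
    · simp [hij, hi, h0 j]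
  · by_cases hij : j = i
    · subst hij; field_simp
    · rw [if_neg hij, if_neg (Ne.symm hij)]; field_simp; ring

/-! ### The transition semigroup -/

section Exponential

attribute [local instance] Matrix.linftyOpNormedRing Matrix.linftyOpNormedAlgebra

/-- Only the constant term of the exponential series survives multiplication by `J`. With `J` the
all-ones matrix this gives the row sums of the semigroup. -/
lemma exp_mul_of_mul_eq_zero {A J : Matrix (Fin n) (Fin n) ℝ} (h : A * J = 0) :
    NormedSpace.exp A * J = J := by
  have hs := (NormedSpace.exp_series_hasSum_exp' (𝕂 := ℝ) A).mul_right J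
  have h1 : ∀ k : ℕ, k ≠ 0 → ((k.factorial : ℝ)⁻¹ • A ^ k) * J = 0 := by
    intro k hk
    obtain ⟨m, rfl⟩ := Nat.exists_eq_succ_of_ne_zero hk
    rw [pow_succ, smul_mul_assoc, mul_assoc, h, mul_zero, smul_zero]
  have := hasSum_single 0 h1
  have e := hs.unique this
  rw [Nat.factorial_zero, Nat.cast_one, inv_one, one_smul, pow_zero, one_mul] at e
  exact e

lemma exp_apply_nonneg {A : Matrix (Fin n) (Fin n) ℝ} (hA : ∀ i j, 0 ≤ A i j) (i j : Fin n) :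
    0 ≤ NormedSpace.exp A i j := by
  have hs := NormedSpace.exp_series_hasSum_exp' (𝕂 := ℝ) A
  have hpow : ∀ k : ℕ, ∀ i j, 0 ≤ (A ^ k) i j := by
    intro k
    induction k with
    | zero => intro i j; rw [pow_zero, Matrix.one_apply]; positivity
    | succ k ih =>
      intro i j
      rw [pow_succ, Matrix.mul_apply]
      exact Finset.sum_nonneg fun m _ => mul_nonneg (ih i m) (hA m j)
  have hs' := (Pi.hasSum.1 ((Pi.hasSum.1 hs) i)) j
  exact hs'.nonneg fun k => mul_nonneg (by positivity) (hpow k i j)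

/-- Uniformization: a large enough multiple `c` of the identity makes `A = hQ + c` entrywise
nonnegative, and exp(hQ) = e^{-c} exp A because scalars commute with `A`. -/
lemma IsGenerator.exp_nonneg {Q : Matrix (Fin n) (Fin n) ℝ} (hQ : IsGenerator Q) {h : ℝ}
    (hh : 0 ≤ h) (i j : Fin n) : 0 ≤ NormedSpace.exp (h • Q) i j := by
  set c : ℝ := h * ∑ i, |Q i i| with hc
  set A : Matrix (Fin n) (Fin n) ℝ := h • Q + c • (1 : Matrix (Fin n) (Fin n) ℝ) with hA
  have hA0 : ∀ i j, 0 ≤ A i j := by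
    intro i j
    by_cases hij : i = j
    · subst hij
      have h1 : |Q i i| ≤ ∑ i, |Q i i| :=
        Finset.single_le_sum (f := fun i => |Q i i|) (fun k _ => abs_nonneg _) (Finset.mem_univ i)
      have h2 := neg_abs_le (Q i i)
      have : A i i = h * (Q i i + ∑ i, |Q i i|) := by simp [hA, hc]; ring
      rw [this]
      exact mul_nonneg hh (by linarith)
    · simp [hA, hij, mul_nonneg hh (hQ.offDiag_nonneg i j hij)]
  have hcomm : Commute A ((-c) • (1 : Matrix (Fin n) (Fin n) ℝ)) :=
    (Commute.one_right A).smul_right (-c)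
  have hsum : h • Q = A + (-c) • (1 : Matrix (Fin n) (Fin n) ℝ) := by
    rw [hA, neg_smul, add_neg_cancel_right]
  have hdiag : (-c) • (1 : Matrix (Fin n) (Fin n) ℝ) = Matrix.diagonal (fun _ => -c) := by
    rw [← Matrix.smul_one_eq_diagonal]
  rw [hsum, Matrix.exp_add_of_commute _ _ hcomm, hdiag, Matrix.exp_diagonal, Matrix.mul_diagonal]
  refine mul_nonneg (exp_apply_nonneg hA0 i j) ?_
  rw [Pi.coe_exp, ← Real.exp_eq_exp_ℝ]
  positivity

lemma IsGenerator.exp_row_sum {Q : Matrix (Fin n) (Fin n) ℝ} (hQ : IsGenerator Q) (h : ℝ)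
    (i : Fin n) : ∑ j, NormedSpace.exp (h • Q) i j = 1 := by
  have h0 : (h • Q) * (Matrix.of fun _ _ => (1 : ℝ)) = 0 := by
    ext a b
    simp [Matrix.mul_apply, ← Finset.mul_sum, hQ.row_sum]
  have := congrFun (congrFun (exp_mul_of_mul_eq_zero h0) i) i
  simpa [Matrix.mul_apply] using this

lemma tendsto_exp_taylor (Q : Matrix (Fin n) (Fin n) ℝ) (i j : Fin n) :
    Tendsto (fun h : ℝ => h⁻¹ * (NormedSpace.exp (h • Q) i j - (1 : Matrix (Fin n) (Fin n) ℝ) i j)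
      - Q i j) (𝓝[≠] 0) (𝓝 0) := by
  have h1 : HasDerivAt (fun h : ℝ => NormedSpace.exp (h • Q)) Q 0 := by
    have h := hasDerivAt_exp_smul_const (𝕂 := ℝ) Q (0 : ℝ)
    rw [zero_smul, NormedSpace.exp_zero, one_mul] at h
    exact h
  have h2 : HasDerivAt (fun h : ℝ => NormedSpace.exp (h • Q) i j) (Q i j) 0 :=
    (hasDerivAt_pi.1 ((hasDerivAt_pi.1 h1) i)) j
  have h3 := h2.tendsto_slope_zero
  simp only [zero_add, zero_smul, NormedSpace.exp_zero, smul_eq_mul] at h3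
  simpa using h3.sub_const (Q i j)

end Exponential

/-! ### State and local time on a time grid -/

/-- The weight `1 + ∑ⱼ lⱼ`, which a grid step of size `h` increases by `h`. -/
def weight (l : Fin n → ℝ) : ℝ := 1 + ∑ j, l j

lemma one_le_weight {l : Fin n → ℝ} (hl : 0 ≤ l) : 1 ≤ weight l := by
  have : 0 ≤ ∑ j, l j := Finset.sum_nonneg fun j _ => hl j
  unfold weight; linarith

lemma weight_add_single (l : Fin n → ℝ) (j : Fin n) (h : ℝ) :
    weight (l + Pi.single j h) = weight l + h := by
  simp [weight, Finset.sum_add_distrib, add_assoc]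

lemma add_single_nonneg {l : Fin n → ℝ} (hl : 0 ≤ l) (j : Fin n) {h : ℝ} (hh : -(l j) ≤ h) :
    0 ≤ l + Pi.single j h := by
  intro k
  by_cases hk : k = j
  · subst hk; simp; linarith
  · simpa [hk] using hl k

lemma add_single_nonneg' {l : Fin n → ℝ} (hl : 0 ≤ l) (j : Fin n) {h : ℝ} (hh : 0 ≤ h) :
    0 ≤ l + Pi.single j h :=
  add_single_nonneg hl j ((neg_nonpos.2 (hl j)).trans hh)

/-- One step of the Markov chain with transition matrix `p`, spending time `h` at the new state. -/
def gridStep (p : Matrix (Fin n) (Fin n) ℝ) (h : ℝ) (F : Fin n → (Fin n → ℝ) → ℂ) :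
    Fin n → (Fin n → ℝ) → ℂ :=
  fun i l => ∑ j, (p i j : ℂ) * F j (l + Pi.single j h)

/-- `F` has the one-sided partial derivative `F'` in direction `m` on the orthant. -/
def HasPartial (m : Fin n) (F F' : (Fin n → ℝ) → ℂ) : Prop :=
  ∀ l, 0 ≤ l → HasDerivWithinAt (fun s : ℝ => F (l + Pi.single m s)) (F' l) (Set.Ici (-(l m))) 0

/-- A nonnegative shift only enlarges the interval of admissible increments, so the derivative
restricts to the old one. -/
lemma HasPartial.shift {m : Fin n} {F F' : (Fin n → ℝ) → ℂ} (hF : HasPartial m F F') (j : Fin n)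
    {h : ℝ} (hh : 0 ≤ h) :
    HasPartial m (fun l => F (l + Pi.single j h)) (fun l => F' (l + Pi.single j h)) := by
  intro l hl
  have hm : 0 ≤ (Pi.single j h : Fin n → ℝ) m := by
    rw [Pi.single_apply]; split_ifs <;> linarith
  have hsub : -((l + Pi.single j h : Fin n → ℝ) m) ≤ -(l m) := by
    rw [Pi.add_apply]; linarith
  have h1 := (hF _ (add_single_nonneg' hl j hh)).mono (Set.Ici_subset_Ici.2 hsub)
  simpa only [add_right_comm] using h1

lemma HasPartial.sum {ι : Type*} {s : Finset ι} {m : Fin n} {F F' : ι → (Fin n → ℝ) → ℂ}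
    (c : ι → ℂ) (hF : ∀ k ∈ s, HasPartial m (F k) (F' k)) :
    HasPartial m (fun l => ∑ k ∈ s, c k * F k l) (fun l => ∑ k ∈ s, c k * F' k l) := fun l hl =>
  HasDerivWithinAt.fun_sum fun k hk => (hF k hk l hl).const_mul (c k)

lemma HasPartial.gridStep {m : Fin n} {F F' : Fin n → (Fin n → ℝ) → ℂ}
    (hF : ∀ j, HasPartial m (F j) (F' j)) (p : Matrix (Fin n) (Fin n) ℝ) {h : ℝ} (hh : 0 ≤ h)
    (i : Fin n) : HasPartial m (gridStep p h F i) (gridStep p h F' i) :=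
  HasPartial.sum _ fun j _ => (hF j).shift j hh

lemma HasPartial.gridStep_iterate {m : Fin n} {F F' : Fin n → (Fin n → ℝ) → ℂ}
    (hF : ∀ j, HasPartial m (F j) (F' j)) (p : Matrix (Fin n) (Fin n) ℝ) {h : ℝ} (hh : 0 ≤ h)
    (k : ℕ) : ∀ i, HasPartial m ((Ward.gridStep p h)^[k] F i) ((Ward.gridStep p h)^[k] F' i) := by
  induction k with
  | zero => exact hF
  | succ k ih =>
    simp only [Function.iterate_succ_apply']
    exact HasPartial.gridStep ih p hh

lemma HasPartial.hasDerivWithinAt {m : Fin n} {F F' : (Fin n → ℝ) → ℂ} (hF : HasPartial m F F')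
    {l : Fin n → ℝ} (hl : 0 ≤ l) {s : ℝ} (hs : 0 ≤ s) :
    HasDerivWithinAt (fun s : ℝ => F (l + Pi.single m s)) (F' (l + Pi.single m s)) (Set.Ici 0) s := by
  have h1 := hF _ (add_single_nonneg' hl m hs)
  have h2 : HasDerivWithinAt (fun r : ℝ => r - s) 1 (Set.Ici 0) s :=
    ((hasDerivAt_id s).sub_const s).hasDerivWithinAt
  rw [← sub_self s] at h1
  have h3 := HasDerivWithinAt.scomp (h := fun r => r - s) s h1 h2 (fun r hr => by
    have := hl m
    simp only [Set.mem_Ici, Pi.add_apply, Pi.single_eq_same, Pi.zero_apply] at *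
    linarith)
  rw [one_smul] at h3
  refine h3.congr_of_mem (fun r _ => ?_) hs
  simp [add_assoc, ← Pi.single_add]

lemma HasPartial.norm_sub_le {m : Fin n} {F F' : (Fin n → ℝ) → ℂ} (hF : HasPartial m F F')
    {l : Fin n → ℝ} (hl : 0 ≤ l) {h C : ℝ} (hh : 0 ≤ h)
    (hC : ∀ s, 0 ≤ s → ‖F' (l + Pi.single m s)‖ ≤ C) :
    ‖F (l + Pi.single m h) - F l‖ ≤ C * h := by
  have := Convex.norm_image_sub_le_of_norm_hasDerivWithin_le (𝕜 := ℝ)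
    (fun s hs => hF.hasDerivWithinAt hl hs) (fun s hs => hC s hs) (convex_Ici 0)
    (Set.self_mem_Ici) (Set.mem_Ici.2 hh)
  simpa [abs_of_nonneg hh] using this

/-- The mean value inequality is used twice: for `F'`, and for F minus its linear part, whose
derivative is then at most `C * h`. The sharp factor 1/2 is not needed. -/
lemma HasPartial.norm_taylor_le {m : Fin n} {F F' F'' : (Fin n → ℝ) → ℂ} (hF : HasPartial m F F')
    (hF' : HasPartial m F' F'') {l : Fin n → ℝ} (hl : 0 ≤ l) {h C : ℝ} (hh : 0 ≤ h)
    (hC : ∀ s, 0 ≤ s → ‖F'' (l + Pi.single m s)‖ ≤ C) :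
    ‖F (l + Pi.single m h) - F l - h * F' l‖ ≤ C * h * h := by
  have hlin : ∀ s : ℝ, HasDerivAt (fun s : ℝ => (s : ℂ) * F' l) (1 * F' l) s := fun s =>
    ((hasDerivAt_id s).ofReal_comp).mul_const _
  have hd : ∀ s ∈ Set.Icc 0 h, HasDerivWithinAt
      (fun s : ℝ => F (l + Pi.single m s) - s * F' l)
      (F' (l + Pi.single m s) - 1 * F' l) (Set.Icc 0 h) s := fun s hs =>
    ((hF.hasDerivWithinAt hl hs.1).mono Set.Icc_subset_Ici_self).fun_sub
      (hlin s).hasDerivWithinAt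
  have hC0 : 0 ≤ C := (norm_nonneg _).trans (hC 0 le_rfl)
  have := Convex.norm_image_sub_le_of_norm_hasDerivWithin_le (𝕜 := ℝ) (C := C * h) hd
    (fun s (hs : s ∈ Set.Icc 0 h) => by
      rw [one_mul]
      exact (hF'.norm_sub_le hl hs.1 hC).trans (mul_le_mul_of_nonneg_left hs.2 hC0))
    (convex_Icc 0 h) (Set.left_mem_Icc.2 hh) (Set.right_mem_Icc.2 hh)
  simp only [Pi.single_zero, add_zero, Complex.ofReal_zero, zero_mul, sub_zero,
    Real.norm_eq_abs, abs_of_nonneg hh] at this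
  rwa [sub_right_comm]

/-- The rows of `p` are probability distributions. -/
structure IsTransition (p : Matrix (Fin n) (Fin n) ℝ) : Prop where
  nonneg : ∀ i j, 0 ≤ p i j
  row_sum : ∀ i, ∑ j, p i j = 1

lemma norm_gridStep_le {p : Matrix (Fin n) (Fin n) ℝ} (hp : IsTransition p) {h C : ℝ}
    {F : Fin n → (Fin n → ℝ) → ℂ} {i : Fin n} {l : Fin n → ℝ}
    (hF : ∀ j, ‖F j (l + Pi.single j h)‖ ≤ C) : ‖gridStep p h F i l‖ ≤ C := by
  unfold gridStep
  calc ‖∑ j, (p i j : ℂ) * F j (l + Pi.single j h)‖ ≤ ∑ j, p i j * C := by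
        refine norm_sum_le_of_le _ fun j _ => ?_
        rw [norm_mul, Complex.norm_real, Real.norm_of_nonneg (hp.nonneg i j)]
        exact mul_le_mul_of_nonneg_left (hF j) (hp.nonneg i j)
    _ = C := by rw [← Finset.sum_mul, hp.row_sum, one_mul]

/-- The weight increases by `h` at each step whichever state is visited, so averaging over paths
loses nothing and decay in `l` becomes decay in time. -/
lemma norm_gridStep_iterate_le {p : Matrix (Fin n) (Fin n) ℝ} (hp : IsTransition p) {h C : ℝ}
    (hh : 0 ≤ h) {d : ℕ} {F : Fin n → (Fin n → ℝ) → ℂ}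
    (hF : ∀ j l, 0 ≤ l → ‖F j l‖ ≤ C / weight l ^ d) (k : ℕ) :
    ∀ i l, 0 ≤ l → ‖(gridStep p h)^[k] F i l‖ ≤ C / (weight l + k * h) ^ d := by
  induction k with
  | zero => simpa using hF
  | succ k ih =>
    intro i l hl
    rw [Function.iterate_succ_apply']
    refine norm_gridStep_le hp fun j => (ih j _ (add_single_nonneg' hl j hh)).trans (le_of_eq ?_)
    rw [weight_add_single]
    push_cast
    ring_nf

lemma ContinuousOn.gridStep {F : Fin n → (Fin n → ℝ) → ℂ}
    (hF : ∀ j, ContinuousOn (F j) (Set.Ici 0)) (p : Matrix (Fin n) (Fin n) ℝ) {h : ℝ}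
    (hh : 0 ≤ h) (i : Fin n) : ContinuousOn (gridStep p h F i) (Set.Ici 0) :=
  continuousOn_finsetSum _ fun j _ => continuousOn_const.mul
    ((hF j).comp (by fun_prop) fun _ hl => add_single_nonneg' hl j hh)

lemma ContinuousOn.gridStep_iterate {F : Fin n → (Fin n → ℝ) → ℂ}
    (hF : ∀ j, ContinuousOn (F j) (Set.Ici 0)) (p : Matrix (Fin n) (Fin n) ℝ) {h : ℝ}
    (hh : 0 ≤ h) (k : ℕ) : ∀ i, ContinuousOn ((Ward.gridStep p h)^[k] F i) (Set.Ici 0) := by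
  induction k with
  | zero => exact hF
  | succ k ih =>
    simp only [Function.iterate_succ_apply']
    exact ContinuousOn.gridStep ih p hh

/-- The generator of the joint process of state and local time, applied to `v`, where `v₁ i` is the
partial derivative of `v i` in direction `i`. -/
def genApply (Q : Matrix (Fin n) (Fin n) ℝ) (v v₁ : Fin n → (Fin n → ℝ) → ℂ) :
    Fin n → (Fin n → ℝ) → ℂ :=
  fun i l => v₁ i l + ∑ j, (Q i j : ℂ) * v j l

/-- Consistency of one grid step with the generator. The parameter `τ` stands for the time already
elapsed, so that the error keeps the decay of `v` in time and can be summed over all steps. -/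
lemma norm_gridStep_sub_genApply_le {Q p : Matrix (Fin n) (Fin n) ℝ}
    {h ε C τ : ℝ} {d : ℕ} (hh : 0 ≤ h) (hC : 0 ≤ C) (hτ : 0 ≤ τ)
    (hpQ : ∀ i j, |p i j - (1 : Matrix (Fin n) (Fin n) ℝ) i j - h * Q i j| ≤ h * ε)
    {v v₁ v₂ : Fin n → (Fin n → ℝ) → ℂ} (hv₁ : ∀ i, HasPartial i (v i) (v₁ i))
    (hv₂ : ∀ i, HasPartial i (v₁ i) (v₂ i))
    (hb : ∀ i l, 0 ≤ l → ‖v i l‖ ≤ C / (weight l + τ) ^ d)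
    (hb₁ : ∀ i l, 0 ≤ l → ‖v₁ i l‖ ≤ C / (weight l + τ) ^ d)
    (hb₂ : ∀ i l, 0 ≤ l → ‖v₂ i l‖ ≤ C / (weight l + τ) ^ d)
    (i : Fin n) {l : Fin n → ℝ} (hl : 0 ≤ l) :
    ‖gridStep p h v i l - v i l - h * genApply Q v v₁ i l‖ ≤
      h * (n * ε + h * (∑ i, ∑ j, |Q i j|) + h) * (C / (weight l + τ) ^ d) := by
  set B := C / (weight l + τ) ^ d with hB
  have hw := one_le_weight hl
  have hB0 : 0 ≤ B := by positivity
  have mono : ∀ {u : (Fin n → ℝ) → ℂ} (j : Fin n),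
      (∀ l, 0 ≤ l → ‖u l‖ ≤ C / (weight l + τ) ^ d) → ∀ s, 0 ≤ s →
        ‖u (l + Pi.single j s)‖ ≤ B := by
    intro u j hu s hs
    refine (hu _ (add_single_nonneg' hl j hs)).trans ?_
    rw [weight_add_single, hB]
    gcongr
    linarith
  -- Three sources of error: `p` is not exactly 1 + hQ, the Q-term is evaluated at a shifted local
  -- time, and the diagonal term is linearized in the local time.
  have split : gridStep p h v i l - v i l - h * genApply Q v v₁ i l =
      ∑ j, ((p i j - (1 : Matrix (Fin n) (Fin n) ℝ) i j - h * Q i j : ℝ) : ℂ) *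
        v j (l + Pi.single j h) +
      ∑ j, ((h * Q i j : ℝ) : ℂ) * (v j (l + Pi.single j h) - v j l) +
      (v i (l + Pi.single i h) - v i l - h * v₁ i l) := by
    have h1 : ∑ j, (((1 : Matrix (Fin n) (Fin n) ℝ) i j : ℝ) : ℂ) * v j (l + Pi.single j h) =
        v i (l + Pi.single i h) := by
      simp [Matrix.one_apply, apply_ite (Complex.ofReal)]
    unfold gridStep genApply
    simp only [Complex.ofReal_sub, sub_mul, Finset.sum_sub_distrib, mul_sub, h1, mul_add,
      Finset.mul_sum, Complex.ofReal_mul, mul_assoc]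
    ring
  have e1 : ‖∑ j, ((p i j - (1 : Matrix (Fin n) (Fin n) ℝ) i j - h * Q i j : ℝ) : ℂ) *
        v j (l + Pi.single j h)‖ ≤ h * (n * ε) * B := by
    calc _ ≤ ∑ j : Fin n, (h * ε) * B := norm_sum_le_of_le _ fun j _ => by
          rw [norm_mul, Complex.norm_real, Real.norm_eq_abs]
          exact mul_le_mul (hpQ i j) (mono j (hb j) h hh) (norm_nonneg _)
            ((abs_nonneg _).trans (hpQ i j))
      _ = _ := by simp; ring
  have e2 : ‖∑ j, ((h * Q i j : ℝ) : ℂ) * (v j (l + Pi.single j h) - v j l)‖ ≤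
      h * (h * (∑ i, ∑ j, |Q i j|)) * B := by
    calc _ ≤ ∑ j : Fin n, (h * |Q i j|) * (B * h) := norm_sum_le_of_le _ fun j _ => by
          rw [norm_mul, Complex.norm_real, Real.norm_eq_abs, abs_mul, abs_of_nonneg hh]
          exact mul_le_mul_of_nonneg_left
            ((hv₁ j).norm_sub_le hl hh (mono j (hb₁ j))) (by positivity)
      _ = (∑ j, |Q i j|) * (h * h * B) := by rw [Finset.sum_mul]; congr 1; ext j; ring
      _ ≤ (∑ i, ∑ j, |Q i j|) * (h * h * B) := by
          refine mul_le_mul_of_nonneg_right ?_ (by positivity)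
          exact Finset.single_le_sum (f := fun i => ∑ j, |Q i j|)
            (fun k _ => Finset.sum_nonneg fun _ _ => abs_nonneg _) (Finset.mem_univ i)
      _ = _ := by ring
  have e3 := (hv₁ i).norm_taylor_le (hv₂ i) hl hh (mono i (hb₂ i))
  rw [split]
  refine (norm_add₃_le).trans ((add_le_add (add_le_add e1 e2) e3).trans (le_of_eq ?_))
  ring

/-- Each term is at most 1/(1+kh) - 1/(1+(k+1)h), which telescopes; the bound is uniform in the mesh
and in the number of terms. -/
lemma sum_div_sq_le {h : ℝ} (hh : 0 ≤ h) (K : ℕ) :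
    ∑ k ∈ Finset.range K, h / (1 + ((k + 1 : ℕ) : ℝ) * h) ^ 2 ≤ 1 - 1 / (1 + K * h) := by
  induction K with
  | zero => simp
  | succ K ih =>
    rw [Finset.sum_range_succ]
    have h1 : 0 < 1 + (K : ℝ) * h := by positivity
    have h2 : 0 < 1 + ((K + 1 : ℕ) : ℝ) * h := by positivity
    have key : h / (1 + ((K + 1 : ℕ) : ℝ) * h) ^ 2 ≤
        1 / (1 + K * h) - 1 / (1 + ((K + 1 : ℕ) : ℝ) * h) := by
      rw [div_sub_div _ _ h1.ne' h2.ne', div_le_div_iff₀ (by positivity) (by positivity)]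
      push_cast at *
      nlinarith [mul_nonneg (mul_nonneg hh hh) h2.le]
    linarith

/-- Of the `d + 2` powers, two pay for the sum over time and `d` remain as decay in the starting
point. -/
lemma sum_div_weight_le {h w : ℝ} (hh : 0 ≤ h) (hw : 1 ≤ w) (d K : ℕ) :
    ∑ k ∈ Finset.range K, h / (w + ((k + 1 : ℕ) : ℝ) * h) ^ (d + 2) ≤ 1 / w ^ d := by
  have h1 : ∀ k : ℕ, h / (w + ((k + 1 : ℕ) : ℝ) * h) ^ (d + 2) ≤
      1 / w ^ d * (h / (1 + ((k + 1 : ℕ) : ℝ) * h) ^ 2) := by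
    intro k
    rw [pow_add, div_mul_div_comm, one_mul]
    have : 0 ≤ ((k + 1 : ℕ) : ℝ) * h := by positivity
    gcongr
    linarith
  calc _ ≤ ∑ k ∈ Finset.range K, 1 / w ^ d * (h / (1 + ((k + 1 : ℕ) : ℝ) * h) ^ 2) :=
        Finset.sum_le_sum fun k _ => h1 k
    _ ≤ 1 / w ^ d * 1 := by
        rw [← Finset.mul_sum]
        refine mul_le_mul_of_nonneg_left ((sum_div_sq_le hh K).trans ?_) (by positivity)
        have : 0 ≤ 1 / (1 + (K : ℝ) * h) := by positivity
        linarith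
    _ = _ := mul_one _

/-! ### Grid potentials: uniform bounds and the telescoping generator -/

section

/-- A family of functions that decay on the orthant faster than every power of the weight. -/
def RapidDecay {ι : Type*} (F : ι → (Fin n → ℝ) → ℂ) : Prop :=
  ∀ d : ℕ, ∃ C : ℝ, 0 ≤ C ∧ ∀ j l, 0 ≤ l → ‖F j l‖ ≤ C / weight l ^ d

/-- The mesh size of the `N`-th time grid. -/
def mesh (N : ℕ) : ℝ := ((N : ℝ) + 1)⁻¹

lemma mesh_pos (N : ℕ) : 0 < mesh N := by unfold mesh; positivity

lemma tendsto_mesh : Tendsto mesh atTop (𝓝 0) := by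
  have : mesh = fun N : ℕ => 1 / ((N : ℝ) + 1) := by ext N; simp [mesh]
  rw [this]
  exact tendsto_one_div_add_atTop_nhds_zero_nat (𝕜 := ℝ)

/-- The transition matrix over one step of the `N`-th grid. -/
def gridMatrix (Q : Matrix (Fin n) (Fin n) ℝ) (N : ℕ) : Matrix (Fin n) (Fin n) ℝ :=
  NormedSpace.exp (mesh N • Q)

lemma IsGenerator.isTransition {Q : Matrix (Fin n) (Fin n) ℝ} (hQ : IsGenerator Q) (N : ℕ) :
    IsTransition (gridMatrix Q N) :=
  ⟨fun i j => hQ.exp_nonneg (mesh_pos N).le i j, fun i => hQ.exp_row_sum _ i⟩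

/-- The expectations along the `N`-th grid. -/
def gridExpect (Q : Matrix (Fin n) (Fin n) ℝ) (f : Fin n → (Fin n → ℝ) → ℂ) (N k : ℕ) :
    Fin n → (Fin n → ℝ) → ℂ :=
  (gridStep (gridMatrix Q N) (mesh N))^[k] f

/-- The Riemann sum for the potential over the `N`-th grid. -/
def gridPotential (Q : Matrix (Fin n) (Fin n) ℝ) (f : Fin n → (Fin n → ℝ) → ℂ) (N : ℕ) :
    Fin n → (Fin n → ℝ) → ℂ :=
  fun i l => ∑ k ∈ Finset.range ((N + 1) ^ 2), (mesh N : ℂ) * gridExpect Q f N (k + 1) i l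

lemma norm_gridExpect_le {Q : Matrix (Fin n) (Fin n) ℝ} (hQ : IsGenerator Q)
    {f : Fin n → (Fin n → ℝ) → ℂ} {C : ℝ} {d : ℕ}
    (hf : ∀ j l, 0 ≤ l → ‖f j l‖ ≤ C / weight l ^ d) (N k : ℕ) (i : Fin n) {l : Fin n → ℝ}
    (hl : 0 ≤ l) : ‖gridExpect Q f N k i l‖ ≤ C / (weight l + k * mesh N) ^ d :=
  norm_gridStep_iterate_le (hQ.isTransition N) (mesh_pos N).le hf k i l hl

/-- The constant is independent of `N`, so the bound dominates the brackets and passes to the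
pointwise limit. -/
lemma RapidDecay.gridPotential {Q : Matrix (Fin n) (Fin n) ℝ} (hQ : IsGenerator Q)
    {f : Fin n → (Fin n → ℝ) → ℂ} (hf : RapidDecay f) (d : ℕ) :
    ∃ C, 0 ≤ C ∧ ∀ N i l, 0 ≤ l → ‖gridPotential Q f N i l‖ ≤ C / weight l ^ d := by
  obtain ⟨C, hC, hb⟩ := hf (d + 2)
  refine ⟨C, hC, fun N i l hl => ?_⟩
  have hm := mesh_pos N
  calc ‖Ward.gridPotential Q f N i l‖
      ≤ ∑ k ∈ Finset.range ((N + 1) ^ 2),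
          C * (mesh N / (weight l + ((k + 1 : ℕ) : ℝ) * mesh N) ^ (d + 2)) := by
        refine norm_sum_le_of_le _ fun k _ => ?_
        rw [norm_mul, Complex.norm_real, Real.norm_of_nonneg hm.le]
        refine (mul_le_mul_of_nonneg_left (norm_gridExpect_le hQ hb N (k + 1) i hl)
          hm.le).trans (le_of_eq ?_)
        ring
    _ ≤ C * (1 / weight l ^ d) := by
        rw [← Finset.mul_sum]
        exact mul_le_mul_of_nonneg_left (sum_div_weight_le hm.le (one_le_weight hl) d _) hC
    _ = _ := by ring

lemma HasPartial.gridPotential {m : Fin n} {f f' : Fin n → (Fin n → ℝ) → ℂ}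
    (hf : ∀ j, HasPartial m (f j) (f' j)) (Q : Matrix (Fin n) (Fin n) ℝ) (N : ℕ) (i : Fin n) :
    HasPartial m (gridPotential Q f N i) (gridPotential Q f' N i) :=
  HasPartial.sum _ fun k _ => HasPartial.gridStep_iterate hf _ (mesh_pos N).le (k + 1) i

lemma ContinuousOn.gridPotential {f : Fin n → (Fin n → ℝ) → ℂ}
    (hf : ∀ j, ContinuousOn (f j) (Set.Ici 0)) (Q : Matrix (Fin n) (Fin n) ℝ) (N : ℕ)
    (i : Fin n) : ContinuousOn (gridPotential Q f N i) (Set.Ici 0) :=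
  continuousOn_finsetSum _ fun k _ => continuousOn_const.mul
    (ContinuousOn.gridStep_iterate hf _ (mesh_pos N).le (k + 1) i)

/-- The error rate of the generator approximation on the `N`-th grid. -/
def gridError (Q : Matrix (Fin n) (Fin n) ℝ) (N : ℕ) : ℝ :=
  ∑ i, ∑ j, |(mesh N)⁻¹ * (gridMatrix Q N i j - (1 : Matrix (Fin n) (Fin n) ℝ) i j) - Q i j|

lemma tendsto_gridError (Q : Matrix (Fin n) (Fin n) ℝ) :
    Tendsto (gridError Q) atTop (𝓝 0) := by
  have hm : Tendsto mesh atTop (𝓝[≠] 0) :=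
    tendsto_nhdsWithin_iff.2 ⟨tendsto_mesh, Eventually.of_forall fun N => (mesh_pos N).ne'⟩
  have : Tendsto (gridError Q) atTop (𝓝 (∑ i : Fin n, ∑ j : Fin n, |(0 : ℝ)|)) :=
    tendsto_finsetSum _ fun i _ => tendsto_finsetSum _ fun j _ =>
      ((tendsto_exp_taylor Q i j).comp hm).abs
  simpa using this

lemma abs_gridMatrix_sub_le (Q : Matrix (Fin n) (Fin n) ℝ) (N : ℕ) (i j : Fin n) :
    |gridMatrix Q N i j - (1 : Matrix (Fin n) (Fin n) ℝ) i j - mesh N * Q i j| ≤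
      mesh N * gridError Q N := by
  have hm := mesh_pos N
  have h1 : |(mesh N)⁻¹ * (gridMatrix Q N i j - (1 : Matrix (Fin n) (Fin n) ℝ) i j) - Q i j| ≤
      gridError Q N :=
    (Finset.single_le_sum (f := fun j => |(mesh N)⁻¹ * (gridMatrix Q N i j -
      (1 : Matrix (Fin n) (Fin n) ℝ) i j) - Q i j|) (fun _ _ => abs_nonneg _)
        (Finset.mem_univ j)).trans
    (Finset.single_le_sum (f := fun i => ∑ j, |(mesh N)⁻¹ * (gridMatrix Q N i j -
      (1 : Matrix (Fin n) (Fin n) ℝ) i j) - Q i j|)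
        (fun _ _ => Finset.sum_nonneg fun _ _ => abs_nonneg _) (Finset.mem_univ i))
  calc _ = mesh N * |(mesh N)⁻¹ * (gridMatrix Q N i j - (1 : Matrix (Fin n) (Fin n) ℝ) i j)
        - Q i j| := by
        rw [← abs_of_pos hm, ← abs_mul, abs_of_pos hm, mul_sub, mul_inv_cancel_left₀ hm.ne']
    _ ≤ _ := mul_le_mul_of_nonneg_left h1 hm.le

/-- The relative error of the generator approximation on the `N`-th grid. -/
def gridRate (Q : Matrix (Fin n) (Fin n) ℝ) (N : ℕ) : ℝ :=
  n * gridError Q N + mesh N * (∑ i, ∑ j, |Q i j|) + mesh N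

lemma tendsto_gridRate (Q : Matrix (Fin n) (Fin n) ℝ) : Tendsto (gridRate Q) atTop (𝓝 0) := by
  have : gridRate Q = fun N =>
      n * gridError Q N + mesh N * (∑ i, ∑ j, |Q i j|) + mesh N := rfl
  rw [this]
  simpa using (((tendsto_gridError Q).const_mul (n : ℝ)).add
    (tendsto_mesh.mul_const (∑ i, ∑ j, |Q i j|))).add tendsto_mesh

lemma gridRate_nonneg (Q : Matrix (Fin n) (Fin n) ℝ) (N : ℕ) : 0 ≤ gridRate Q N := by
  have := (mesh_pos N).le
  have : 0 ≤ gridError Q N := Finset.sum_nonneg fun _ _ => Finset.sum_nonneg fun _ _ => abs_nonneg _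
  have : 0 ≤ ∑ i, ∑ j, |Q i j| := Finset.sum_nonneg fun _ _ => Finset.sum_nonneg fun _ _ => abs_nonneg _
  unfold gridRate; positivity

/-- A family of functions on the orthant together with its first and second partial derivatives,
all of them rapidly decaying. -/
structure SmoothFamily (f : Fin n → (Fin n → ℝ) → ℂ) (D D₂ : Fin n → Fin n → (Fin n → ℝ) → ℂ) :
    Prop where
  hasPartial : ∀ m j, HasPartial m (f j) (D m j)
  hasPartial₂ : ∀ m j, HasPartial m (D m j) (D₂ m j)
  continuousOn : ∀ j, ContinuousOn (f j) (Set.Ici 0)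
  continuousOn₁ : ∀ m j, ContinuousOn (D m j) (Set.Ici 0)
  decay : RapidDecay f
  decay₁ : RapidDecay fun x : Fin n × Fin n => D x.1 x.2
  decay₂ : RapidDecay fun x : Fin n × Fin n => D₂ x.1 x.2

variable {Q : Matrix (Fin n) (Fin n) ℝ} {f : Fin n → (Fin n → ℝ) → ℂ}
  {D D₂ : Fin n → Fin n → (Fin n → ℝ) → ℂ}

lemma SmoothFamily.exists_bound (hf : SmoothFamily f D D₂) (d : ℕ) :
    ∃ C, 0 ≤ C ∧ (∀ j l, 0 ≤ l → ‖f j l‖ ≤ C / weight l ^ d) ∧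
      (∀ m j l, 0 ≤ l → ‖D m j l‖ ≤ C / weight l ^ d) ∧
      (∀ m j l, 0 ≤ l → ‖D₂ m j l‖ ≤ C / weight l ^ d) := by
  obtain ⟨C₀, h₀, hb₀⟩ := hf.decay d
  obtain ⟨C₁, h₁, hb₁⟩ := hf.decay₁ d
  obtain ⟨C₂, h₂, hb₂⟩ := hf.decay₂ d
  have mono : ∀ {C l}, 0 ≤ l → C ≤ C₀ + C₁ + C₂ →
      C / weight l ^ d ≤ (C₀ + C₁ + C₂) / weight (n := n) l ^ d := fun hl hC =>
    div_le_div_of_nonneg_right hC (pow_nonneg (zero_le_one.trans (one_le_weight hl)) d)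
  exact ⟨C₀ + C₁ + C₂, by positivity,
    fun j l hl => (hb₀ j l hl).trans (mono hl (by linarith)),
    fun m j l hl => (hb₁ (m, j) l hl).trans (mono hl (by linarith)),
    fun m j l hl => (hb₂ (m, j) l hl).trans (mono hl (by linarith))⟩

/-- One grid step changes the grid expectations by the generator, up to a small relative error. -/
lemma SmoothFamily.norm_gridExpect_succ_sub_le (hf : SmoothFamily f D D₂) (hQ : IsGenerator Q)
    {d : ℕ} {C : ℝ} (hC : 0 ≤ C) (hb : ∀ j l, 0 ≤ l → ‖f j l‖ ≤ C / weight l ^ d)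
    (hb₁ : ∀ m j l, 0 ≤ l → ‖D m j l‖ ≤ C / weight l ^ d)
    (hb₂ : ∀ m j l, 0 ≤ l → ‖D₂ m j l‖ ≤ C / weight l ^ d)
    (N k : ℕ) (i : Fin n) {l : Fin n → ℝ} (hl : 0 ≤ l) :
    ‖gridExpect Q f N (k + 1) i l - gridExpect Q f N k i l - mesh N *
        genApply Q (gridExpect Q f N k) (fun i => gridExpect Q (D i) N k i) i l‖ ≤
      mesh N * gridRate Q N * (C / (weight l + k * mesh N) ^ d) := by
  have hm := (mesh_pos N).le
  have := norm_gridStep_sub_genApply_le (Q := Q) (p := gridMatrix Q N) (τ := k * mesh N) hm hC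
    (by positivity) (abs_gridMatrix_sub_le Q N) (v := gridExpect Q f N k)
    (v₁ := fun i => gridExpect Q (D i) N k i) (v₂ := fun i => gridExpect Q (D₂ i) N k i)
    (fun i => HasPartial.gridStep_iterate (hf.hasPartial i) _ hm k i)
    (fun i => HasPartial.gridStep_iterate (hf.hasPartial₂ i) _ hm k i)
    (fun i l hl => norm_gridExpect_le hQ hb N k i hl)
    (fun i l hl => norm_gridExpect_le hQ (hb₁ i) N k i hl)
    (fun i l hl => norm_gridExpect_le hQ (hb₂ i) N k i hl) i hl
  unfold gridExpect at this ⊢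
  rw [Function.iterate_succ_apply']
  exact this

lemma mesh_mul_genApply_sum (K : ℕ) (i : Fin n) (l : Fin n → ℝ) (N : ℕ) :
    genApply Q (fun i l => ∑ k ∈ Finset.range K, (mesh N : ℂ) * gridExpect Q f N (k + 1) i l)
      (fun i l => ∑ k ∈ Finset.range K, (mesh N : ℂ) * gridExpect Q (D i) N (k + 1) i l) i l =
    ∑ k ∈ Finset.range K, (mesh N : ℂ) * genApply Q (gridExpect Q f N (k + 1))
      (fun i => gridExpect Q (D i) N (k + 1) i) i l := by
  simp only [genApply, mul_add, Finset.sum_add_distrib, Finset.mul_sum]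
  congr 1
  rw [Finset.sum_comm]
  refine Finset.sum_congr rfl fun k _ => Finset.sum_congr rfl fun j _ => by ring

/-- The generator applied to the grid potential telescopes, up to a small error. -/
lemma SmoothFamily.norm_genApply_gridPotential_sub_le (hf : SmoothFamily f D D₂)
    (hQ : IsGenerator Q) (d : ℕ) : ∃ C, 0 ≤ C ∧ ∀ N i l, 0 ≤ l →
      ‖genApply Q (gridPotential Q f N) (fun i => gridPotential Q (D i) N i) i l -
        (gridExpect Q f N ((N + 1) ^ 2 + 1) i l - gridExpect Q f N 1 i l)‖ ≤
      gridRate Q N * (C / weight l ^ d) := by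
  obtain ⟨C, hC, hb, hb₁, hb₂⟩ := hf.exists_bound (d + 2)
  refine ⟨C, hC, fun N i l hl => ?_⟩
  set K := (N + 1) ^ 2
  have h1 : genApply Q (gridPotential Q f N) (fun i => gridPotential Q (D i) N i) i l =
      ∑ k ∈ Finset.range K, (mesh N : ℂ) * genApply Q (gridExpect Q f N (k + 1))
        (fun i => gridExpect Q (D i) N (k + 1) i) i l := mesh_mul_genApply_sum K i l N
  have h2 : gridExpect Q f N (K + 1) i l - gridExpect Q f N 1 i l =
      ∑ k ∈ Finset.range K, (gridExpect Q f N (k + 1 + 1) i l - gridExpect Q f N (k + 1) i l) :=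
    (Finset.sum_range_sub (fun k => gridExpect Q f N (k + 1) i l) K).symm
  rw [h1, h2, norm_sub_rev, ← Finset.sum_sub_distrib]
  calc _ ≤ ∑ k ∈ Finset.range K, gridRate Q N * C *
          (mesh N / (weight l + ((k + 1 : ℕ) : ℝ) * mesh N) ^ (d + 2)) :=
        norm_sum_le_of_le _ fun k _ =>
          (hf.norm_gridExpect_succ_sub_le hQ hC hb hb₁ hb₂ N (k + 1) i hl).trans
            (le_of_eq (by ring))
    _ ≤ gridRate Q N * C * (1 / weight l ^ d) := by
        rw [← Finset.mul_sum]
        exact mul_le_mul_of_nonneg_left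
          (sum_div_weight_le (mesh_pos N).le (one_le_weight hl) d _)
          (mul_nonneg (gridRate_nonneg Q N) hC)
    _ = _ := by ring

/-- The upper end of the telescope lies beyond time `N + 1`, since (N+1)² steps of size 1/(N+1) have
been made; one power of decay suffices. -/
lemma RapidDecay.tendsto_gridExpect_zero (hf : RapidDecay f) (hQ : IsGenerator Q) (i : Fin n)
    {l : Fin n → ℝ} (hl : 0 ≤ l) :
    Tendsto (fun N => gridExpect Q f N ((N + 1) ^ 2 + 1) i l) atTop (𝓝 0) := by
  obtain ⟨C, hC, hb⟩ := hf 1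
  refine squeeze_zero_norm (a := fun N => C * mesh N) (fun N => ?_)
    (by simpa using tendsto_mesh.const_mul C)
  refine (norm_gridExpect_le hQ hb N _ i hl).trans ?_
  have hw := one_le_weight hl
  have hm := mesh_pos N
  rw [pow_one, div_eq_mul_inv]
  refine mul_le_mul_of_nonneg_left ?_ hC
  have h1 : (N : ℝ) + 1 ≤ weight l + (((N + 1) ^ 2 + 1 : ℕ) : ℝ) * mesh N := by
    have h2 : ((N : ℝ) + 1) * mesh N = 1 := mul_inv_cancel₀ (by positivity)
    push_cast
    nlinarith
  exact inv_anti₀ (by positivity) h1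

lemma SmoothFamily.tendsto_gridExpect_one (hf : SmoothFamily f D D₂) (hQ : IsGenerator Q)
    (i : Fin n) {l : Fin n → ℝ} (hl : 0 ≤ l) :
    Tendsto (fun N => gridExpect Q f N 1 i l) atTop (𝓝 (f i l)) := by
  obtain ⟨C, hC, hb, hb₁, hb₂⟩ := hf.exists_bound 0
  have h0 : Tendsto (fun N => gridExpect Q f N 1 i l - f i l -
      mesh N * genApply Q f (fun i => D i i) i l) atTop (𝓝 0) := by
    refine squeeze_zero_norm (fun N =>
      hf.norm_gridExpect_succ_sub_le hQ hC hb hb₁ hb₂ N 0 i hl) ?_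
    simpa using (tendsto_mesh.mul (tendsto_gridRate Q)).mul_const C
  have h1 : Tendsto (fun N => (mesh N : ℂ) * genApply Q f (fun i => D i i) i l) atTop (𝓝 0) := by
    simpa using ((Complex.continuous_ofReal.tendsto 0).comp tendsto_mesh).mul_const
      (genApply Q f (fun i => D i i) i l)
  simpa using (h0.add h1).add_const (f i l)

/-- The grid form of Av = -f: the telescoped sum leaves a late expectation, which vanishes, minus a
one-step expectation, which tends to `f`. -/
lemma SmoothFamily.tendsto_genApply_gridPotential (hf : SmoothFamily f D D₂)
    (hQ : IsGenerator Q) (i : Fin n) {l : Fin n → ℝ} (hl : 0 ≤ l) :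
    Tendsto (fun N => genApply Q (gridPotential Q f N) (fun i => gridPotential Q (D i) N i) i l)
      atTop (𝓝 (-f i l)) := by
  obtain ⟨C, hC, hb⟩ := hf.norm_genApply_gridPotential_sub_le hQ 0
  have h0 := squeeze_zero_norm (fun N => hb N i l hl)
    (zero_mul (C / weight l ^ 0) ▸ (tendsto_gridRate Q).mul_const (C / weight l ^ 0))
  simpa using h0.add ((hf.decay.tendsto_gridExpect_zero hQ i hl).sub
    (hf.tendsto_gridExpect_one hQ i hl))

lemma SmoothFamily.norm_genApply_gridPotential_le (hf : SmoothFamily f D D₂)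
    (hQ : IsGenerator Q) (d : ℕ) : ∃ C, 0 ≤ C ∧ ∀ N i l, 0 ≤ l →
      ‖genApply Q (gridPotential Q f N) (fun i => gridPotential Q (D i) N i) i l‖ ≤
      C / weight l ^ d := by
  obtain ⟨C, hC, hb⟩ := hf.norm_genApply_gridPotential_sub_le hQ d
  obtain ⟨C', hC', hb'⟩ := hf.decay d
  obtain ⟨R, hR⟩ := (tendsto_gridRate Q).bddAbove_range
  have hR' : ∀ N, gridRate Q N ≤ R := fun N => hR ⟨N, rfl⟩
  have hR0 : 0 ≤ R := (gridRate_nonneg Q 0).trans (hR' 0)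
  refine ⟨R * C + (C' + C'), by positivity, fun N i l hl => ?_⟩
  have hw := one_le_weight hl
  have hw' : 0 ≤ C / weight l ^ d := by positivity
  have h1 : ∀ k, ‖gridExpect Q f N k i l‖ ≤ C' / weight l ^ d := fun k =>
    (norm_gridExpect_le hQ hb' N k i hl).trans (by
      have := (mesh_pos N).le
      have : 0 ≤ k * mesh N := by positivity
      gcongr
      linarith)
  have h2 := norm_sub_le_of_le (h1 ((N + 1) ^ 2 + 1)) (h1 1)
  have h3 := (norm_sub_norm_le _ _).trans ((hb N i l hl).trans
    (mul_le_mul_of_nonneg_right (hR' N) hw'))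
  rw [add_div, add_div, mul_div_assoc]
  linarith

end

/-! ### The twisted Gaussian density and integrability -/

lemma absSq_nonneg (φ : Fin n → ℂ) : 0 ≤ absSq φ := fun i => Complex.normSq_nonneg (φ i)

lemma continuous_absSq : Continuous (absSq : (Fin n → ℂ) → Fin n → ℝ) :=
  continuous_pi fun i => Complex.continuous_normSq.comp (continuous_apply i)

lemma continuous_weight : Continuous (weight : (Fin n → ℝ) → ℝ) := by
  unfold weight; fun_prop

lemma sq_one_add_norm_le (φ : Fin n → ℂ) : (1 + ‖φ‖) ^ 2 ≤ 2 * weight (absSq φ) := by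
  have hs : 0 ≤ ∑ i, absSq φ i := Finset.sum_nonneg fun i _ => absSq_nonneg φ i
  have h1 : ‖φ‖ ≤ √(∑ i, absSq φ i) := by
    refine (pi_norm_le_iff_of_nonneg (Real.sqrt_nonneg _)).2 fun i => ?_
    refine Real.le_sqrt_of_sq_le ?_
    rw [← Complex.normSq_eq_norm_sq]
    exact Finset.single_le_sum (f := absSq φ) (fun i _ => absSq_nonneg φ i) (Finset.mem_univ i)
  have h2 : ‖φ‖ ^ 2 ≤ ∑ i, absSq φ i := by
    rw [← Real.sq_sqrt hs]; gcongr
  unfold weight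
  nlinarith [sq_nonneg (1 - ‖φ‖)]

lemma exists_integrable_envelope (n k : ℕ) : ∃ d : ℕ, Integrable
    (fun φ : Fin n → ℂ => (1 + ‖φ‖) ^ k / weight (absSq φ) ^ d) := by
  -- An exponent above the real dimension makes (1+‖φ‖)^(-M) integrable; `d = k + M` is generous, as
  -- the weight is quadratic in φ.
  set M := Module.finrank ℝ (Fin n → ℂ) + 1
  have hint : Integrable (fun φ : Fin n → ℂ => (2 : ℝ) ^ (k + M) * (1 + ‖φ‖) ^ (-(M : ℝ))) :=
    (integrable_one_add_norm (by simp [M])).const_mul _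
  refine ⟨k + M, hint.mono' (Continuous.aestronglyMeasurable ?_) (ae_of_all _ fun φ => ?_)⟩
  · refine Continuous.div (by fun_prop) ((continuous_weight.comp continuous_absSq).pow _)
      fun φ => pow_ne_zero _ ?_
    linarith [one_le_weight (absSq_nonneg φ)]
  · have hw := one_le_weight (absSq_nonneg φ)
    have h1 : 1 ≤ 1 + ‖φ‖ := by linarith [norm_nonneg φ]
    rw [Real.norm_of_nonneg (by positivity), Real.rpow_neg (by positivity), Real.rpow_natCast,
      ← div_eq_mul_inv, div_le_div_iff₀ (by positivity) (by positivity), ← pow_add, ← mul_pow]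
    calc (1 + ‖φ‖) ^ (k + M) ≤ ((1 + ‖φ‖) ^ 2) ^ (k + M) := by
          gcongr
          nlinarith
      _ ≤ _ := by gcongr; exact sq_one_add_norm_le φ

/-- The real part is -½ Σ Q_ij |φ_i - φ_j|²: the squares |φ_i|² and |φ_j|² drop out because rows and
columns of Q both sum to 0, and the diagonal does not contribute. -/
lemma IsGenerator.re_form_nonpos {Q : Matrix (Fin n) (Fin n) ℝ} (hQ : IsGenerator Q)
    (φ : Fin n → ℂ) : (∑ i, ∑ j, φ i * ((Q i j : ℂ) * conj (φ j))).re ≤ 0 := by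
  have h1 : (∑ i, ∑ j, φ i * ((Q i j : ℂ) * conj (φ j))).re =
      ∑ i, ∑ j, Q i j * ((φ i).re * (φ j).re + (φ i).im * (φ j).im) := by
    simp only [Complex.re_sum]
    refine Finset.sum_congr rfl fun i _ => Finset.sum_congr rfl fun j _ => ?_
    simp
    ring
  have h2 : ∑ i, ∑ j, Q i j * Complex.normSq (φ i) = 0 := by
    simp [← Finset.sum_mul, hQ.row_sum]
  have h3 : ∑ i, ∑ j, Q i j * Complex.normSq (φ j) = 0 := by
    rw [Finset.sum_comm]
    simp [← Finset.sum_mul, hQ.col_sum]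
  have h4 : 0 ≤ ∑ i, ∑ j, Q i j * Complex.normSq (φ i - φ j) := by
    refine Finset.sum_nonneg fun i _ => Finset.sum_nonneg fun j _ => ?_
    by_cases hij : i = j
    · simp [hij]
    · exact mul_nonneg (hQ.offDiag_nonneg i j hij) (Complex.normSq_nonneg _)
  have h5 : ∑ i, ∑ j, Q i j * Complex.normSq (φ i - φ j) =
      ∑ i, ∑ j, Q i j * Complex.normSq (φ i) + ∑ i, ∑ j, Q i j * Complex.normSq (φ j) -
      2 * ∑ i, ∑ j, Q i j * ((φ i).re * (φ j).re + (φ i).im * (φ j).im) := by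
    simp only [Finset.mul_sum, ← Finset.sum_add_distrib, ← Finset.sum_sub_distrib]
    refine Finset.sum_congr rfl fun i _ => Finset.sum_congr rfl fun j _ => ?_
    simp only [Complex.normSq_apply, Complex.sub_re, Complex.sub_im]
    ring
  rw [h1]
  linarith

lemma IsGenerator.norm_density_le_one {Q : Matrix (Fin n) (Fin n) ℝ} (hQ : IsGenerator Q)
    (φ : Fin n → ℂ) : ‖density Q φ‖ ≤ 1 := by
  unfold density
  rw [norm_mul, Complex.norm_exp, norm_inv, norm_pow, Complex.norm_real,
    Real.norm_of_nonneg Real.pi_pos.le]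
  refine mul_le_one₀ ?_ (Real.exp_pos _).le (Real.exp_le_one_iff.2 (hQ.re_form_nonpos φ))
  exact inv_le_one_of_one_le₀ (one_le_pow₀ (by linarith [Real.pi_gt_three]))

lemma continuous_density (Q : Matrix (Fin n) (Fin n) ℝ) : Continuous (density Q) := by
  unfold density
  have : Continuous (conj : ℂ → ℂ) := Complex.continuous_conj
  fun_prop

/-- A bound for `F`, uniform in the parameter, gives a dominating function for the bracket. -/
lemma IsGenerator.exists_dominating {Q : Matrix (Fin n) (Fin n) ℝ} (hQ : IsGenerator Q)
    {a : (Fin n → ℂ) → ℂ} (ha : Function.HasTemperateGrowth a) {ι : Type*}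
    {F : ι → (Fin n → ℝ) → ℂ}
    (hF : ∀ d : ℕ, ∃ C, 0 ≤ C ∧ ∀ x l, 0 ≤ l → ‖F x l‖ ≤ C / weight l ^ d) :
    ∃ B : (Fin n → ℂ) → ℝ, Integrable B ∧
      ∀ x φ, ‖a φ * F x (absSq φ) * density Q φ‖ ≤ B φ := by
  obtain ⟨k, A, hA⟩ := ha.2 0
  obtain ⟨d, hd⟩ := exists_integrable_envelope n k
  obtain ⟨C, hC, hb⟩ := hF d
  refine ⟨fun φ => A * C * ((1 + ‖φ‖) ^ k / weight (absSq φ) ^ d), hd.const_mul _,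
    fun x φ => ?_⟩
  have h1 := hA φ
  rw [norm_iteratedFDeriv_zero] at h1
  have h2 := hb x _ (absSq_nonneg φ)
  have h3 := hQ.norm_density_le_one φ
  rw [norm_mul, norm_mul]
  calc _ ≤ A * (1 + ‖φ‖) ^ k * (C / weight (absSq φ) ^ d) * 1 :=
        mul_le_mul (mul_le_mul h1 h2 (norm_nonneg _) ((norm_nonneg _).trans h1)) h3
          (norm_nonneg _) (mul_nonneg ((norm_nonneg _).trans h1) ((norm_nonneg _).trans h2))
    _ = _ := by ring

lemma IsGenerator.integrable_mul_density {Q : Matrix (Fin n) (Fin n) ℝ} (hQ : IsGenerator Q)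
    {a : (Fin n → ℂ) → ℂ} (ha : Function.HasTemperateGrowth a) {F : (Fin n → ℝ) → ℂ}
    (hFm : AEStronglyMeasurable fun φ : Fin n → ℂ => F (absSq φ))
    (hF : ∀ d : ℕ, ∃ C, 0 ≤ C ∧ ∀ l, 0 ≤ l → ‖F l‖ ≤ C / weight l ^ d) :
    Integrable fun φ => a φ * F (absSq φ) * density Q φ := by
  obtain ⟨B, hB, hb⟩ := hQ.exists_dominating ha (ι := Unit) (F := fun _ => F) fun d => by
    obtain ⟨C, hC, h⟩ := hF d
    exact ⟨C, hC, fun _ => h⟩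
  exact hB.mono' ((ha.1.continuous.aestronglyMeasurable.mul hFm).mul
    (continuous_density Q).aestronglyMeasurable) (ae_of_all _ (hb ()))

lemma continuous_comp_absSq {F : (Fin n → ℝ) → ℂ} (hF : ContinuousOn F (Set.Ici 0)) :
    Continuous fun φ : Fin n → ℂ => F (absSq φ) :=
  hF.comp_continuous continuous_absSq absSq_nonneg

lemma hasTemperateGrowth_apply (i : Fin n) :
    Function.HasTemperateGrowth fun φ : Fin n → ℂ => φ i :=
  (ContinuousLinearMap.proj (R := ℝ) (φ := fun _ : Fin n => ℂ) i).hasTemperateGrowth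

lemma hasTemperateGrowth_conj_apply (i : Fin n) :
    Function.HasTemperateGrowth fun φ : Fin n → ℂ => conj (φ i) :=
  ((Complex.conjCLE : ℂ →L[ℝ] ℂ).comp
    (ContinuousLinearMap.proj (R := ℝ) (φ := fun _ : Fin n => ℂ) i)).hasTemperateGrowth

lemma hasTemperateGrowth_fderiv_apply {g : (Fin n → ℂ) → ℂ} (hg : Function.HasTemperateGrowth g)
    (v : Fin n → ℂ) : Function.HasTemperateGrowth fun φ => fderiv ℝ g φ v :=
  ⟨(hg.1.fderiv_right (m := (⊤ : ℕ∞)) (by simp)).clm_apply contDiff_const, fun k => by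
    obtain ⟨d, C, h⟩ := hg.2 (k + 1)
    have hs : ContDiff ℝ (⊤ : ℕ∞) (fderiv ℝ g) := hg.1.fderiv_right (by simp)
    refine ⟨d, ‖v‖ * C, fun φ => ?_⟩
    refine (norm_iteratedFDeriv_clm_apply_const (N := (⊤ : ℕ∞)) hs.contDiffAt
      (by exact_mod_cast le_top)).trans ?_
    rw [norm_iteratedFDeriv_fderiv, mul_assoc]
    exact mul_le_mul_of_nonneg_left (h φ) (norm_nonneg v)⟩

lemma hasLineDerivAt_density (Q : Matrix (Fin n) (Fin n) ℝ) (φ : Fin n → ℂ) (i : Fin n) (c : ℂ) :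
    HasLineDerivAt ℝ (density Q)
      ((c * ∑ j, (Q i j : ℂ) * conj (φ j) + conj c * ∑ j, φ j * (Q j i : ℂ)) * density Q φ)
      φ (Pi.single i c) := by
  unfold HasLineDerivAt density
  set s : Fin n → ℂ := Pi.single i c with hs
  have hid : HasDerivAt (fun t : ℝ => (t : ℂ)) 1 0 := (hasDerivAt_id (0 : ℝ)).ofReal_comp
  have hlin : ∀ a b : ℂ, HasDerivAt (fun t : ℝ => a + (t : ℂ) * b) b 0 := fun a b => by
    simpa using (hid.mul_const b).const_add a
  have hsum : HasDerivAt (fun t : ℝ => ∑ a, ∑ b, (φ + t • s) a * ((Q a b : ℂ) *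
      conj ((φ + t • s) b)))
      (∑ a, ∑ b, (s a * ((Q a b : ℂ) * conj (φ b)) + φ a * ((Q a b : ℂ) * conj (s b)))) 0 := by
    refine HasDerivAt.fun_sum fun a _ => HasDerivAt.fun_sum fun b _ => ?_
    have := (hlin (φ a) (s a)).fun_mul ((hlin (conj (φ b)) (conj (s b))).const_mul (Q a b : ℂ))
    simpa using this
  have hval : ∑ a, ∑ b, (s a * ((Q a b : ℂ) * conj (φ b)) + φ a * ((Q a b : ℂ) * conj (s b))) =
      c * ∑ j, (Q i j : ℂ) * conj (φ j) + conj c * ∑ j, φ j * (Q j i : ℂ) := by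
    simp only [Finset.sum_add_distrib]
    congr 1
    · simp [hs, Pi.single_apply, Finset.mul_sum]
    · simp only [hs, Pi.single_apply, apply_ite conj, map_zero, mul_ite, mul_zero,
        Finset.sum_ite_eq', Finset.mem_univ, if_true, Finset.mul_sum]
      exact Finset.sum_congr rfl fun a _ => by ring
  rw [hval] at hsum
  have := hsum.cexp.const_mul (((Real.pi : ℂ) ^ n)⁻¹)
  simp only [zero_smul, add_zero] at this
  exact this.congr_deriv (by ring)

lemma absSq_add_smul_single (φ : Fin n → ℂ) (i : Fin n) (c : ℂ) (t : ℝ) :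
    absSq (φ + t • (Pi.single i c : Fin n → ℂ)) = absSq φ + Pi.single i
      (Complex.normSq (φ i + t * c) - Complex.normSq (φ i)) := by
  ext k
  by_cases hk : k = i
  · subst hk; simp [absSq]
  · simp [absSq, hk]

/-- A two-sided derivative arises even where `F` has only a one-sided one, because |φ_i + tc|² ≥ 0
keeps the argument in the orthant for all t. Line derivatives are used since `HasPartial` controls
one direction only. -/
lemma HasPartial.hasLineDerivAt_comp_absSq {i : Fin n} {F F' : (Fin n → ℝ) → ℂ}
    (hF : HasPartial i F F') (φ : Fin n → ℂ) (c : ℂ) :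
    HasLineDerivAt ℝ (fun φ => F (absSq φ))
      ((φ i * conj c + c * conj (φ i)) * F' (absSq φ)) φ (Pi.single i c) := by
  unfold HasLineDerivAt
  simp only [absSq_add_smul_single]
  have h1 := hF _ (absSq_nonneg φ)
  have h2 : HasDerivAt (fun t : ℝ => Complex.normSq (φ i + t * c) - Complex.normSq (φ i))
      (2 * ((φ i).re * c.re + (φ i).im * c.im)) 0 := by
    have e : (fun t : ℝ => Complex.normSq (φ i + t * c) - Complex.normSq (φ i)) =
        fun t : ℝ => t * (2 * ((φ i).re * c.re + (φ i).im * c.im)) + t ^ 2 * Complex.normSq c := by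
      ext t
      simp [Complex.normSq_apply]
      ring
    rw [e]
    simpa using ((hasDerivAt_id (0 : ℝ)).mul_const _).fun_add
      (((hasDerivAt_id (0 : ℝ)).fun_pow 2).mul_const (Complex.normSq c))
  have h3 : HasDerivWithinAt (fun s : ℝ => F (absSq φ + Pi.single i s)) (F' (absSq φ))
      (Set.Ici (-(absSq φ i)))
      ((fun t : ℝ => Complex.normSq (φ i + t * c) - Complex.normSq (φ i)) 0) := by
    simpa using h1
  have h4 := HasDerivWithinAt.scomp (s := Set.univ) 0 h3 h2.hasDerivWithinAt
    (fun t _ => by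
      have := Complex.normSq_nonneg (φ i + t * c)
      simp only [Set.mem_Ici, absSq]
      linarith)
  rw [hasDerivWithinAt_univ] at h4
  refine h4.congr_deriv ?_
  rw [Complex.real_smul]
  congr 1
  apply Complex.ext <;> simp <;> ring

/-! ### Integration by parts and the limit of the grid identities -/

section

lemma hasTemperateGrowth_wirtingerBar {g : (Fin n → ℂ) → ℂ} (hg : PropertyG g) (i : Fin n) :
    Function.HasTemperateGrowth (wirtingerBar i g) := by
  have h1 := hasTemperateGrowth_fderiv_apply hg (Pi.single i 1)
  have h2 := hasTemperateGrowth_fderiv_apply hg (Pi.single i Complex.I)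
  unfold wirtingerBar
  fun_prop

section IntegrationByParts

variable {Q : Matrix (Fin n) (Fin n) ℝ} {g : (Fin n → ℂ) → ℂ} {F F' : (Fin n → ℝ) → ℂ}
  {i : Fin n}

/-- The line derivative of `F (φ φ̄) exp ⟨φ, Q φ̄⟩` in direction `c eᵢ`. -/
def lineDerivDensity (Q : Matrix (Fin n) (Fin n) ℝ) (F F' : (Fin n → ℝ) → ℂ) (i : Fin n) (c : ℂ)
    (φ : Fin n → ℂ) : ℂ :=
  ((φ i * conj c + c * conj (φ i)) * F' (absSq φ)) * density Q φ + F (absSq φ) *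
    ((c * ∑ j, (Q i j : ℂ) * conj (φ j) + conj c * ∑ j, φ j * (Q j i : ℂ)) * density Q φ)

lemma integrable_mul_lineDerivDensity (hQ : IsGenerator Q) (hg : PropertyG g)
    (hFc : ContinuousOn F (Set.Ici 0)) (hFc' : ContinuousOn F' (Set.Ici 0))
    (hFd : ∀ d : ℕ, ∃ C, 0 ≤ C ∧ ∀ l, 0 ≤ l → ‖F l‖ ≤ C / weight l ^ d)
    (hFd' : ∀ d : ℕ, ∃ C, 0 ≤ C ∧ ∀ l, 0 ≤ l → ‖F' l‖ ≤ C / weight l ^ d) (c : ℂ) :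
    Integrable fun φ => g φ * lineDerivDensity Q F F' i c φ := by
  have h1 := hQ.integrable_mul_density
    (a := fun φ => g φ * (φ i * conj c + c * conj (φ i)))
    (hg.mul (((hasTemperateGrowth_apply i).mul (.const _)).add
      ((Function.HasTemperateGrowth.const _).mul (hasTemperateGrowth_conj_apply i))))
    (continuous_comp_absSq hFc').aestronglyMeasurable hFd'
  have h2 := hQ.integrable_mul_density
    (a := fun φ => g φ * (c * ∑ j, (Q i j : ℂ) * conj (φ j) + conj c * ∑ j, φ j * (Q j i : ℂ)))
    (hg.mul (((Function.HasTemperateGrowth.const c).mul (.sum fun j _ =>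
      (Function.HasTemperateGrowth.const _).mul (hasTemperateGrowth_conj_apply j))).add
      ((Function.HasTemperateGrowth.const (conj c)).mul (.sum fun j _ =>
      (hasTemperateGrowth_apply j).mul (.const _)))))
    (continuous_comp_absSq hFc).aestronglyMeasurable hFd
  refine (h1.add h2).congr (ae_of_all _ fun φ => ?_)
  simp only [Pi.add_apply, lineDerivDensity]
  ring

lemma integral_mul_lineDerivDensity (hQ : IsGenerator Q) (hg : PropertyG g)
    (hF : HasPartial i F F')
    (hFc : ContinuousOn F (Set.Ici 0)) (hFc' : ContinuousOn F' (Set.Ici 0))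
    (hFd : ∀ d : ℕ, ∃ C, 0 ≤ C ∧ ∀ l, 0 ≤ l → ‖F l‖ ≤ C / weight l ^ d)
    (hFd' : ∀ d : ℕ, ∃ C, 0 ≤ C ∧ ∀ l, 0 ≤ l → ‖F' l‖ ≤ C / weight l ^ d) (c : ℂ) :
    ∫ φ, g φ * lineDerivDensity Q F F' i c φ =
      -∫ φ, fderiv ℝ g φ (Pi.single i c) * (F (absSq φ) * density Q φ) := by
  have hm := (continuous_comp_absSq hFc).aestronglyMeasurable (μ := volume)
  have hdiff : Differentiable ℝ g := hg.1.differentiable (by simp)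
  have i1 : Integrable fun φ => fderiv ℝ g φ (Pi.single i c) * (F (absSq φ) * density Q φ) := by
    simpa only [mul_assoc] using
      hQ.integrable_mul_density (hasTemperateGrowth_fderiv_apply hg (Pi.single i c)) hm hFd
  have i2 : Integrable fun φ => g φ * (F (absSq φ) * density Q φ) := by
    simpa only [mul_assoc] using hQ.integrable_mul_density hg hm hFd
  have hline : ∀ φ, HasLineDerivAt ℝ (fun φ => F (absSq φ) * density Q φ)
      (lineDerivDensity Q F F' i c φ) φ (Pi.single i c) := fun φ => by
    have h1 := hF.hasLineDerivAt_comp_absSq φ c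
    have h2 := hasLineDerivAt_density Q φ i c
    unfold HasLineDerivAt at h1 h2 ⊢
    have h3 := h1.fun_mul h2
    simp only [zero_smul, add_zero] at h3
    exact h3
  exact integral_bilinear_hasLineDerivAt_right_eq_neg_left_of_integrable (f := g)
    (f' := fun φ => fderiv ℝ g φ (Pi.single i c)) (g := fun φ => F (absSq φ) * density Q φ)
    (g' := lineDerivDensity Q F F' i c)
    (B := ContinuousLinearMap.mul ℝ ℂ) (v := Pi.single i c)
    i1 (integrable_mul_lineDerivDensity hQ hg hFc hFc' hFd hFd' c) i2
    (fun φ _ => (hdiff φ).hasFDerivAt.hasLineDerivAt _) (fun φ _ => hline φ)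

/-- The line identities for c = 1 and c = I are combined as in ∂/∂φ̄_i; the terms with φ̄ cancel by
I² = -1, leaving column `i` of Q. -/
lemma bracket_wirtingerBar_mul (hQ : IsGenerator Q) (hg : PropertyG g)
    (hF : HasPartial i F F')
    (hFc : ContinuousOn F (Set.Ici 0)) (hFc' : ContinuousOn F' (Set.Ici 0))
    (hFd : ∀ d : ℕ, ∃ C, 0 ≤ C ∧ ∀ l, 0 ≤ l → ‖F l‖ ≤ C / weight l ^ d)
    (hFd' : ∀ d : ℕ, ∃ C, 0 ≤ C ∧ ∀ l, 0 ≤ l → ‖F' l‖ ≤ C / weight l ^ d) :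
    bracket Q (fun φ => wirtingerBar i g φ * F (absSq φ)) =
      -(bracket Q (fun φ => φ i * g φ * F' (absSq φ)) +
        ∑ j, bracket Q fun φ => φ j * g φ * ((Q j i : ℂ) * F (absSq φ))) := by
  have hm := (continuous_comp_absSq hFc).aestronglyMeasurable (μ := volume)
  have hm' := (continuous_comp_absSq hFc').aestronglyMeasurable (μ := volume)
  have hint : ∀ c, Integrable fun φ => fderiv ℝ g φ (Pi.single i c) * (F (absSq φ) * density Q φ) :=
    fun c => by
      simpa only [mul_assoc] using
        hQ.integrable_mul_density (hasTemperateGrowth_fderiv_apply hg (Pi.single i c)) hm hFd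
  have e := fun c => integral_mul_lineDerivDensity hQ hg hF hFc hFc' hFd hFd' c
  have l1 : bracket Q (fun φ => wirtingerBar i g φ * F (absSq φ)) =
      -(1 / 2 * ((∫ φ, g φ * lineDerivDensity Q F F' i 1 φ) +
        Complex.I * ∫ φ, g φ * lineDerivDensity Q F F' i Complex.I φ)) := by
    have : bracket Q (fun φ => wirtingerBar i g φ * F (absSq φ)) =
        1 / 2 * ((∫ φ, fderiv ℝ g φ (Pi.single i 1) * (F (absSq φ) * density Q φ)) +
          Complex.I * ∫ φ, fderiv ℝ g φ (Pi.single i Complex.I) * (F (absSq φ) * density Q φ)) := by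
      rw [← integral_const_mul, ← integral_add (hint 1) ((hint Complex.I).const_mul _),
        ← integral_const_mul]
      refine integral_congr_ae (ae_of_all _ fun φ => ?_)
      simp only [wirtingerBar]
      ring
    rw [this, e 1, e Complex.I]
    ring
  have hi := fun c => integrable_mul_lineDerivDensity (i := i) hQ hg hFc hFc' hFd hFd' c
  have i1 : Integrable fun φ => φ i * g φ * F' (absSq φ) * density Q φ :=
    hQ.integrable_mul_density (a := fun φ => φ i * g φ) ((hasTemperateGrowth_apply i).mul hg) hm' hFd'
  have i2 : ∀ j, Integrable fun φ => φ j * g φ * ((Q j i : ℂ) * F (absSq φ)) * density Q φ :=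
    fun j => (hQ.integrable_mul_density (a := fun φ => φ j * g φ * (Q j i : ℂ))
      (((hasTemperateGrowth_apply j).mul hg).mul (.const _))
      hm hFd).congr (ae_of_all _ fun φ => by ring)
  rw [l1, ← integral_const_mul, ← integral_add (hi 1) ((hi Complex.I).const_mul _),
    ← integral_const_mul]
  unfold bracket
  rw [← integral_finsetSum _ (fun j _ => i2 j), ← integral_add i1
    (integrable_finsetSum _ fun j _ => i2 j)]
  congr 1
  refine integral_congr_ae (ae_of_all _ fun φ => ?_)
  have hs : ∑ j, φ j * g φ * ((Q j i : ℂ) * F (absSq φ)) * density Q φ =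
      g φ * F (absSq φ) * density Q φ * ∑ j, φ j * (Q j i : ℂ) := by
    rw [Finset.mul_sum]
    exact Finset.sum_congr rfl fun j _ => by ring
  simp only [hs, lineDerivDensity, map_one, Complex.conj_I]
  have hI := Complex.I_mul_I
  linear_combination (g φ * density Q φ * (1 / 2) *
    ((conj (φ i) - φ i) * F' (absSq φ) + F (absSq φ) *
      (∑ j, (Q i j : ℂ) * conj (φ j) - ∑ j, φ j * (Q j i : ℂ)))) * hI

end IntegrationByParts

variable {Q : Matrix (Fin n) (Fin n) ℝ} {f : Fin n → (Fin n → ℝ) → ℂ}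
  {D D₂ : Fin n → Fin n → (Fin n → ℝ) → ℂ} {g : (Fin n → ℂ) → ℂ}

lemma sum_bracket_wirtingerBar_mul (hQ : IsGenerator Q) (hg : PropertyG g)
    {v v₁ : Fin n → (Fin n → ℝ) → ℂ} (hv : ∀ i, HasPartial i (v i) (v₁ i))
    (hc : ∀ i, ContinuousOn (v i) (Set.Ici 0)) (hc₁ : ∀ i, ContinuousOn (v₁ i) (Set.Ici 0))
    (hd : ∀ i, ∀ d : ℕ, ∃ C, 0 ≤ C ∧ ∀ l, 0 ≤ l → ‖v i l‖ ≤ C / weight l ^ d)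
    (hd₁ : ∀ i, ∀ d : ℕ, ∃ C, 0 ≤ C ∧ ∀ l, 0 ≤ l → ‖v₁ i l‖ ≤ C / weight l ^ d) :
    ∑ i, bracket Q (fun φ => wirtingerBar i g φ * v i (absSq φ)) =
      -∑ i, bracket Q (fun φ => φ i * g φ * genApply Q v v₁ i (absSq φ)) := by
  have h1 : ∀ i, bracket Q (fun φ => φ i * g φ * genApply Q v v₁ i (absSq φ)) =
      bracket Q (fun φ => φ i * g φ * v₁ i (absSq φ)) +
        ∑ j, bracket Q fun φ => φ i * g φ * ((Q i j : ℂ) * v j (absSq φ)) := by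
    intro i
    have i1 : Integrable fun φ => φ i * g φ * v₁ i (absSq φ) * density Q φ :=
      hQ.integrable_mul_density (a := fun φ => φ i * g φ) ((hasTemperateGrowth_apply i).mul hg)
        (continuous_comp_absSq (hc₁ i)).aestronglyMeasurable (hd₁ i)
    have i2 : ∀ j, Integrable fun φ => φ i * g φ * ((Q i j : ℂ) * v j (absSq φ)) * density Q φ :=
      fun j => (hQ.integrable_mul_density (a := fun φ => φ i * g φ * (Q i j : ℂ))
        (((hasTemperateGrowth_apply i).mul hg).mul (.const _))
        (continuous_comp_absSq (hc j)).aestronglyMeasurable (hd j)).congr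
        (ae_of_all _ fun φ => by ring)
    unfold bracket
    rw [← integral_finsetSum _ (fun j _ => i2 j), ← integral_add i1
      (integrable_finsetSum _ fun j _ => i2 j)]
    refine integral_congr_ae (ae_of_all _ fun φ => ?_)
    simp only [genApply, mul_add, add_mul, Finset.mul_sum, Finset.sum_mul]
  simp only [h1, bracket_wirtingerBar_mul hQ hg (hv _) (hc _) (hc₁ _) (hd _) (hd₁ _),
    Finset.sum_neg_distrib, Finset.sum_add_distrib]
  -- Exchanging the indices turns columns of Q into rows, so that `genApply` appears.
  rw [Finset.sum_comm]

/-- The Ward identity, for any pointwise limit of the grid potentials. -/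
lemma SmoothFamily.ward_of_tendsto (hf : SmoothFamily f D D₂) (hQ : IsGenerator Q)
    (hg : PropertyG g) {R : Fin n → (Fin n → ℝ) → ℂ}
    (hR : ∀ i l, 0 ≤ l → Tendsto (fun N => gridPotential Q f N i l) atTop (𝓝 (R i l))) :
    (∀ i, BracketIntegrable Q (fun φ => φ i * g φ * f i (absSq φ))) ∧
      (∀ i, BracketIntegrable Q (fun φ => wirtingerBar i g φ * R i (absSq φ))) ∧
      ∑ i, bracket Q (fun φ => φ i * g φ * f i (absSq φ)) =
        ∑ i, bracket Q (fun φ => wirtingerBar i g φ * R i (absSq φ)) := by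
  have hw := hasTemperateGrowth_wirtingerBar hg
  have hS := hf.decay.gridPotential hQ
  have hD : ∀ m, RapidDecay (D m) := fun m d => by
    obtain ⟨C, hC, h⟩ := hf.decay₁ d
    exact ⟨C, hC, fun j => h (m, j)⟩
  have hScont : ∀ N i, ContinuousOn (gridPotential Q f N i) (Set.Ici 0) := fun N =>
    ContinuousOn.gridPotential hf.continuousOn Q N
  have hDcont : ∀ N i, ContinuousOn (gridPotential Q (D i) N i) (Set.Ici 0) := fun N i =>
    ContinuousOn.gridPotential (hf.continuousOn₁ i) Q N i
  have hGcont : ∀ N i, ContinuousOn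
      (genApply Q (gridPotential Q f N) (fun i => gridPotential Q (D i) N i) i) (Set.Ici 0) :=
    fun N i => (hDcont N i).add
      (continuousOn_finsetSum _ fun j _ => continuousOn_const.mul (hScont N j))
  have hRd : ∀ i, ∀ d : ℕ, ∃ C, 0 ≤ C ∧ ∀ l, 0 ≤ l → ‖R i l‖ ≤ C / weight l ^ d := fun i d => by
    obtain ⟨C, hC, h⟩ := hS d
    exact ⟨C, hC, fun l hl => le_of_tendsto (hR i l hl).norm
      (Eventually.of_forall fun N => h N i l hl)⟩
  -- No regularity of `R` is assumed: measurability, like decay, is inherited from the grid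
  -- potentials.
  have hRm : ∀ i, AEStronglyMeasurable fun φ : Fin n → ℂ => R i (absSq φ) := fun i =>
    aestronglyMeasurable_of_tendsto_ae atTop
      (fun N => (continuous_comp_absSq (hScont N i)).aestronglyMeasurable)
      (ae_of_all _ fun φ => hR i _ (absSq_nonneg φ))
  refine ⟨fun i => hQ.integrable_mul_density (a := fun φ => φ i * g φ) ((hasTemperateGrowth_apply i).mul hg)
    (continuous_comp_absSq (hf.continuousOn i)).aestronglyMeasurable
    (fun d => by obtain ⟨C, hC, h⟩ := hf.decay d; exact ⟨C, hC, h i⟩),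
    fun i => hQ.integrable_mul_density (hw i) (hRm i) (hRd i), ?_⟩
  have key : ∀ N, ∑ i, bracket Q (fun φ => wirtingerBar i g φ * gridPotential Q f N i (absSq φ)) =
      -∑ i, bracket Q (fun φ => φ i * g φ * genApply Q (gridPotential Q f N)
        (fun i => gridPotential Q (D i) N i) i (absSq φ)) := fun N =>
    sum_bracket_wirtingerBar_mul hQ hg
      (fun i => HasPartial.gridPotential (hf.hasPartial i) Q N i) (hScont N) (hDcont N)
      (fun i d => by obtain ⟨C, hC, h⟩ := hS d; exact ⟨C, hC, h N i⟩)
      (fun i d => by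
        obtain ⟨C, hC, h⟩ := (hD i).gridPotential hQ d; exact ⟨C, hC, h N i⟩)
  have lim1 : Tendsto (fun N => ∑ i, bracket Q
      (fun φ => wirtingerBar i g φ * gridPotential Q f N i (absSq φ))) atTop
      (𝓝 (∑ i, bracket Q (fun φ => wirtingerBar i g φ * R i (absSq φ)))) := by
    refine tendsto_finsetSum _ fun i _ => ?_
    obtain ⟨B, hB, hb⟩ := hQ.exists_dominating (hw i) (ι := ℕ)
      (F := fun N => gridPotential Q f N i) fun d => by
        obtain ⟨C, hC, h⟩ := hS d; exact ⟨C, hC, fun N => h N i⟩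
    exact tendsto_integral_of_dominated_convergence B
      (fun N => (((hw i).1.continuous.mul (continuous_comp_absSq (hScont N i))).mul
        (continuous_density Q)).aestronglyMeasurable) hB (fun N => ae_of_all _ (hb N))
      (ae_of_all _ fun φ => ((hR i _ (absSq_nonneg φ)).const_mul _).mul_const _)
  have lim2 : Tendsto (fun N => ∑ i, bracket Q (fun φ => φ i * g φ *
      genApply Q (gridPotential Q f N) (fun i => gridPotential Q (D i) N i) i (absSq φ))) atTop
      (𝓝 (∑ i, bracket Q (fun φ => φ i * g φ * -f i (absSq φ)))) := by
    refine tendsto_finsetSum _ fun i _ => ?_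
    have ha : Function.HasTemperateGrowth fun φ : Fin n → ℂ => φ i * g φ :=
      (hasTemperateGrowth_apply i).mul hg
    obtain ⟨B, hB, hb⟩ := hQ.exists_dominating ha (ι := ℕ)
      (F := fun N => genApply Q (gridPotential Q f N) (fun i => gridPotential Q (D i) N i) i)
      fun d => by
        obtain ⟨C, hC, h⟩ := hf.norm_genApply_gridPotential_le hQ d
        exact ⟨C, hC, fun N => h N i⟩
    exact tendsto_integral_of_dominated_convergence B
      (fun N => ((ha.1.continuous.mul (continuous_comp_absSq (hGcont N i))).mul
        (continuous_density Q)).aestronglyMeasurable) hB (fun N => ae_of_all _ (hb N))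
      (ae_of_all _ fun φ => ((hf.tendsto_genApply_gridPotential hQ i
        (absSq_nonneg φ)).const_mul _).mul_const _)
  have := tendsto_nhds_unique lim1 ((lim2.neg).congr fun N => (key N).symm)
  rw [this]
  simp [bracket, integral_neg]

end

/-! ### Grid expectations as expectations over the chain -/

lemma gridStep_iterate_eq_sum (p : Matrix (Fin n) (Fin n) ℝ) (h : ℝ)
    (F : Fin n → (Fin n → ℝ) → ℂ) (k : ℕ) : ∀ (i : Fin n) (l : Fin n → ℝ),
    (gridStep p h)^[k] F i l = ∑ x : Fin (k + 1) → Fin n,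
      (((if x 0 = i then 1 else 0) * ∏ m : Fin k, p (x m.castSucc) (x m.succ) : ℝ) : ℂ) *
        F (x (Fin.last k)) (l + ∑ m : Fin k, Pi.single (x m.succ) h) := by
  induction k with
  | zero =>
    intro i l
    rw [← (Equiv.funUnique (Fin 1) (Fin n)).symm.sum_comp]
    simp [apply_ite (Complex.ofReal)]
  | succ k ih =>
    intro i l
    -- A path splits into its initial state and the remaining path `y`; only the initial state `i`
    -- counts, and the first jump must lead to `y 0`.
    rw [Function.iterate_succ_apply', ← (Fin.consEquiv fun _ => Fin n).sum_comp,
      Fintype.sum_prod_type, Finset.sum_eq_single i]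
    · simp only [gridStep, ih, Finset.mul_sum]
      rw [Finset.sum_comm]
      refine Finset.sum_congr rfl fun y _ => ?_
      rw [Finset.sum_eq_single (y 0)]
      · simp [Fin.consEquiv, Fin.prod_univ_succ, Fin.sum_univ_succ, Fin.castSucc_succ,
          ← Fin.succ_last, add_assoc, mul_assoc]
      · intro j _ hj
        simp [Ne.symm hj]
      · simp
    · intro a _ ha
      simp [Fin.consEquiv, ha]
    · simp

/-- The local time accumulated along the `N`-th grid. -/
def gridLocalTime {Ω : Type*} (X : ℝ → Ω → Fin n) (N k : ℕ) (ω : Ω) : Fin n → ℝ :=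
  ∑ m ∈ Finset.range k, Pi.single (X (((m + 1 : ℕ) : ℝ) * mesh N) ω) (mesh N)

lemma gridLocalTime_nonneg {Ω : Type*} (X : ℝ → Ω → Fin n) (N k : ℕ) (ω : Ω) :
    0 ≤ gridLocalTime X N k ω :=
  Finset.sum_nonneg fun _ _ => Pi.single_nonneg.2 (mesh_pos N).le

/-- Functions of the state and the local time along the grid factor through a finite set. -/
lemma grid_eq_comp {Ω : Type*} (X : ℝ → Ω → Fin n) (f : Fin n → (Fin n → ℝ) → ℂ) (l : Fin n → ℝ) (N k : ℕ) :
    (fun ω => f (X ((k : ℝ) * mesh N) ω) (l + gridLocalTime X N k ω)) =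
      (fun x : Fin (k + 1) → Fin n => f (x (Fin.last k))
        (l + ∑ m : Fin k, Pi.single (x m.succ) (mesh N))) ∘
      fun ω (m : Fin (k + 1)) => X (((m : ℕ) : ℝ) * mesh N) ω := by
  ext ω
  simp [gridLocalTime, Finset.sum_range]

lemma localTime_nonneg {Ω : Type*} (X : ℝ → Ω → Fin n) {t : ℝ} (ht : 0 ≤ t) (ω : Ω) : 0 ≤ localTime X t ω :=
  fun j => intervalIntegral.integral_nonneg ht fun s _ => by
    split_ifs <;> norm_num

section Chain

variable {Ω : Type*} [MeasurableSpace Ω] {Q : Matrix (Fin n) (Fin n) ℝ}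
  {X : ℝ → Ω → Fin n} {ℙ : Fin n → Measure Ω}

lemma IsMarkovChain.measurable_grid (hX : IsMarkovChain Q X ℙ) (N k : ℕ) :
    Measurable fun ω (m : Fin (k + 1)) => X (((m : ℕ) : ℝ) * mesh N) ω :=
  measurable_pi_lambda _ fun m => hX.measurable _ (mul_nonneg (by positivity) (mesh_pos N).le)

lemma IsMarkovChain.measurable_gridObservable (hX : IsMarkovChain Q X ℙ)
    (f : Fin n → (Fin n → ℝ) → ℂ) (l : Fin n → ℝ) (N k : ℕ) :
    Measurable fun ω => f (X ((k : ℝ) * mesh N) ω) (l + gridLocalTime X N k ω) := by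
  rw [grid_eq_comp]
  exact (measurable_of_finite _).comp (hX.measurable_grid N k)

/-- The integrand depends on ω only through the finitely many grid states, whose joint law is given
by the finite-dimensional distributions with equal time increments. -/
lemma IsMarkovChain.gridExpect_eq_integral (hX : IsMarkovChain Q X ℙ) (hQ : IsGenerator Q)
    (f : Fin n → (Fin n → ℝ) → ℂ) (N k : ℕ) (i : Fin n) (l : Fin n → ℝ) :
    gridExpect Q f N k i l =
      ∫ ω, f (X ((k : ℝ) * mesh N) ω) (l + gridLocalTime X N k ω) ∂(ℙ i) := by
  have := hX.isProbabilityMeasure i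
  have hm := hX.measurable_grid N k
  have hh := (mesh_pos N).le
  have hp := hQ.isTransition N
  have : IsProbabilityMeasure ((ℙ i).map fun ω (m : Fin (k + 1)) => X (((m : ℕ) : ℝ) * mesh N) ω) :=
    Measure.isProbabilityMeasure_map hm.aemeasurable
  rw [grid_eq_comp]
  have h1 := integral_map (μ := ℙ i) hm.aemeasurable
    (f := fun x : Fin (k + 1) → Fin n => f (x (Fin.last k))
        (l + ∑ m : Fin k, Pi.single (x m.succ) (mesh N)))
    (measurable_of_finite _).aestronglyMeasurable
  simp only [Function.comp_def]
  rw [← h1, integral_fintype (Integrable.of_finite), gridExpect, gridStep_iterate_eq_sum]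
  refine Finset.sum_congr rfl fun x _ => ?_
  rw [Measure.real, Measure.map_apply hm (measurableSet_singleton x)]
  have hset : (fun ω (m : Fin (k + 1)) => X (((m : ℕ) : ℝ) * mesh N) ω) ⁻¹' {x} =
      {ω | ∀ m, X ((fun m : Fin (k + 1) => ((m : ℕ) : ℝ) * mesh N) m) ω = x m} := by
    ext ω; simp [funext_iff]
  have hmono : Monotone fun m : Fin (k + 1) => ((m : ℕ) : ℝ) * mesh N := fun a b hab =>
    mul_le_mul_of_nonneg_right (by exact_mod_cast hab) hh
  have hstep : ∀ m : Fin k, ((m.succ : ℕ) : ℝ) * mesh N - ((m.castSucc : ℕ) : ℝ) * mesh N =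
      mesh N := fun m => by
    simp only [Fin.val_succ, Fin.val_castSucc]; push_cast; ring
  rw [hset, hX.finiteDimensional i k _ x hmono (by simp), ENNReal.toReal_ofReal]
  · simp only [hstep, Complex.real_smul]
    rfl
  · simp only [hstep]
    exact mul_nonneg (by positivity) (Finset.prod_nonneg fun m _ => hp.nonneg _ _)

end Chain

/-! ### Refining the grid: convergence to the continuous-time chain -/

/-- The index of the grid point strictly to the right of `s`. -/
def gridIndex (N : ℕ) (s : ℝ) : ℕ := ⌊s * ((N : ℝ) + 1)⌋₊ + 1

lemma measurable_gridIndex (N : ℕ) : Measurable (gridIndex N) :=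
  (measurable_of_countable fun k : ℕ => k + 1).comp
    (Nat.measurable_floor.comp (measurable_id.mul_const _))

lemma lt_gridIndex_mul_mesh (N : ℕ) (s : ℝ) : s < gridIndex N s * mesh N := by
  have h : (0 : ℝ) < (N : ℝ) + 1 := by positivity
  rw [mesh, ← div_eq_mul_inv, lt_div_iff₀ h, gridIndex]
  push_cast
  exact Nat.lt_floor_add_one _

lemma gridIndex_mul_mesh_le (N : ℕ) {s : ℝ} (hs : 0 ≤ s) :
    gridIndex N s * mesh N ≤ s + mesh N := by
  have h : (0 : ℝ) < (N : ℝ) + 1 := by positivity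
  have h1 := Nat.floor_le (mul_nonneg hs h.le)
  have h2 : (gridIndex N s : ℝ) * mesh N = ⌊s * ((N : ℝ) + 1)⌋₊ * mesh N + mesh N := by
    rw [gridIndex]; push_cast; ring
  have h3 : s * ((N : ℝ) + 1) * mesh N = s := by
    rw [mul_assoc, mesh, mul_inv_cancel₀ h.ne', mul_one]
  have h4 := mul_le_mul_of_nonneg_right h1 (mesh_pos N).le
  linarith

lemma tendsto_gridIndex_mul_mesh {s : ℝ} (hs : 0 ≤ s) :
    Tendsto (fun N => gridIndex N s * mesh N) atTop (𝓝[≥] s) := by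
  refine tendsto_nhdsWithin_iff.2 ⟨?_, Eventually.of_forall fun N => (lt_gridIndex_mul_mesh N s).le⟩
  refine tendsto_of_tendsto_of_tendsto_of_le_of_le tendsto_const_nhds
    (by simpa using tendsto_mesh.const_add s) (fun N => (lt_gridIndex_mul_mesh N s).le)
    (fun N => gridIndex_mul_mesh_le N hs)

lemma gridIndex_eq {N m : ℕ} {s : ℝ} (h₁ : m * mesh N ≤ s)
    (h₂ : s < ((m + 1 : ℕ) : ℝ) * mesh N) : gridIndex N s = m + 1 := by
  have h : (0 : ℝ) < (N : ℝ) + 1 := by positivity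
  have hm : (0 : ℝ) ≤ m * mesh N := mul_nonneg (by positivity) (mesh_pos N).le
  rw [mesh, ← div_eq_mul_inv, div_le_iff₀ h] at h₁
  rw [mesh, ← div_eq_mul_inv, lt_div_iff₀ h] at h₂
  rw [gridIndex, (Nat.floor_eq_iff (le_trans (by positivity) h₁)).2 ⟨h₁, by exact_mod_cast h₂⟩]

/-- Right-endpoint Riemann sums are integrals of step functions, which puts both time sums, for the
local time and for the potential, within reach of dominated convergence. -/
lemma integral_comp_gridIndex {E : Type*} [NormedAddCommGroup E] [NormedSpace ℝ E]
    [CompleteSpace E] (G : ℕ → E)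
    (N k : ℕ) : IntervalIntegrable (fun s => G (gridIndex N s)) volume 0 (k * mesh N) ∧
      ∫ s in (0 : ℝ)..(k * mesh N), G (gridIndex N s) =
        ∑ m ∈ Finset.range k, mesh N • G (m + 1) := by
  have hh := mesh_pos N
  have hle : ∀ m : ℕ, (m : ℝ) * mesh N ≤ ((m + 1 : ℕ) : ℝ) * mesh N := fun m => by
    push_cast; nlinarith
  have hcongr : ∀ m : ℕ, ∀ᵐ s, s ∈ Set.uIoc ((m : ℝ) * mesh N) (((m + 1 : ℕ) : ℝ) * mesh N) →
      G (m + 1) = G (gridIndex N s) := fun m => by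
    have hne : ∀ᵐ s : ℝ, s ≠ ((m + 1 : ℕ) : ℝ) * mesh N := by
      simp [ae_iff, measure_singleton]
    filter_upwards [hne] with s hs hmem
    rw [Set.uIoc_of_le (hle m)] at hmem
    rw [gridIndex_eq hmem.1.le (lt_of_le_of_ne hmem.2 hs)]
  have hint : ∀ m : ℕ, IntervalIntegrable (fun s => G (gridIndex N s)) volume
      ((m : ℝ) * mesh N) (((m + 1 : ℕ) : ℝ) * mesh N) := fun m =>
    (intervalIntegrable_const (c := G (m + 1))).congr_ae
      ((ae_restrict_iff' measurableSet_uIoc).2 (hcongr m))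
  have hval : ∀ m : ℕ, ∫ s in ((m : ℝ) * mesh N)..(((m + 1 : ℕ) : ℝ) * mesh N),
      G (gridIndex N s) = mesh N • G (m + 1) := fun m => by
    rw [← intervalIntegral.integral_congr_ae (hcongr m), intervalIntegral.integral_const]
    congr 1
    push_cast; ring
  have h0 := IntervalIntegrable.trans_iterate (a := fun m : ℕ => (m : ℝ) * mesh N) (n := k)
    (fun m _ => hint m)
  have h1 := intervalIntegral.sum_integral_adjacent_intervals
    (a := fun m : ℕ => (m : ℝ) * mesh N) (n := k) (fun m _ => hint m)
  simp only [Nat.cast_zero, zero_mul] at h0 h1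
  exact ⟨h0, h1.symm.trans (Finset.sum_congr rfl fun m _ => hval m)⟩

section Chain

variable {Ω : Type*} [MeasurableSpace Ω] {Q : Matrix (Fin n) (Fin n) ℝ}
  {X : ℝ → Ω → Fin n} {ℙ : Fin n → Measure Ω}

/-- The grid points approach `s` from the right, where paths are continuous, and convergence in a
discrete space is eventual equality. -/
lemma IsMarkovChain.eventually_grid_eq (hX : IsMarkovChain Q X ℙ) (ω : Ω) {s : ℝ} (hs : 0 ≤ s) :
    ∀ᶠ N in atTop, X (gridIndex N s * mesh N) ω = X s ω := by
  have h1 : Tendsto (fun N => X (gridIndex N s * mesh N) ω) atTop (𝓝 (X s ω)) :=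
    (hX.rightContinuous ω s hs).tendsto.comp (tendsto_gridIndex_mul_mesh hs)
  rw [nhds_discrete] at h1
  exact tendsto_pure.1 h1

lemma IsMarkovChain.tendsto_gridLocalTime (hX : IsMarkovChain Q X ℙ) (ω : Ω) {t : ℝ}
    (ht : 0 ≤ t) : Tendsto (fun N => gridLocalTime X N (gridIndex N t) ω) atTop
      (𝓝 (localTime X t ω)) := by
  refine tendsto_pi_nhds.2 fun j => ?_
  set G : ℕ → ℕ → ℝ := fun N k => if X ((k : ℝ) * mesh N) ω = j then 1 else 0 with hG
  have hGle : ∀ N k, ‖G N k‖ ≤ 1 := fun N k => by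
    simp only [hG]; split_ifs <;> simp
  have hmeas : ∀ N, Measurable fun s => G N (gridIndex N s) := fun N =>
    (measurable_of_countable (G N)).comp (measurable_gridIndex N)
  have hint : ∀ N a b, IntervalIntegrable (fun s => G N (gridIndex N s)) volume a b :=
    fun N a b => (intervalIntegrable_const (c := (1 : ℝ))).mono_fun
      (hmeas N).aestronglyMeasurable (ae_of_all _ fun s => by simpa using hGle N _)
  -- The grid sum runs past `t` to the next grid point; the excess is at most one mesh.
  have heq : ∀ N, gridLocalTime X N (gridIndex N t) ω j =
      (∫ s in (0 : ℝ)..t, G N (gridIndex N s)) +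
        ∫ s in t..(gridIndex N t * mesh N), G N (gridIndex N s) := fun N => by
    rw [intervalIntegral.integral_add_adjacent_intervals (hint N _ _) (hint N _ _),
      (integral_comp_gridIndex (G N) N (gridIndex N t)).2]
    simp [gridLocalTime, Finset.sum_apply, Pi.single_apply, hG, eq_comm]
  have l1 : Tendsto (fun N => ∫ s in (0 : ℝ)..t, G N (gridIndex N s)) atTop
      (𝓝 (localTime X t ω j)) := by
    refine intervalIntegral.tendsto_integral_filter_of_dominated_convergence (fun _ => 1)
      (Eventually.of_forall fun N => (hmeas N).aestronglyMeasurable)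
      (Eventually.of_forall fun N => ae_of_all _ fun s _ => hGle N _)
      intervalIntegrable_const (ae_of_all _ fun s hs => ?_)
    rw [Set.uIoc_of_le ht] at hs
    refine tendsto_const_nhds.congr' ?_
    filter_upwards [hX.eventually_grid_eq ω hs.1.le] with N hN
    simp only [hG, hN]
  have l2 : Tendsto (fun N => ∫ s in t..(gridIndex N t * mesh N), G N (gridIndex N s)) atTop
      (𝓝 0) := by
    refine squeeze_zero_norm (fun N => ?_) tendsto_mesh
    refine (intervalIntegral.norm_integral_le_of_norm_le_const fun s _ => hGle N _).trans ?_
    rw [one_mul, abs_of_nonneg (by linarith [lt_gridIndex_mul_mesh N t])]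
    linarith [gridIndex_mul_mesh_le N ht]
  simpa [heq] using l1.add l2

variable {f : Fin n → (Fin n → ℝ) → ℂ}

lemma IsMarkovChain.tendsto_gridObservable (hX : IsMarkovChain Q X ℙ)
    (hf : ∀ j, ContinuousOn (f j) (Set.Ici 0)) {l : Fin n → ℝ} (hl : 0 ≤ l) {t : ℝ} (ht : 0 ≤ t)
    (ω : Ω) : Tendsto (fun N => f (X (gridIndex N t * mesh N) ω)
      (l + gridLocalTime X N (gridIndex N t) ω)) atTop (𝓝 (observable X f l t ω)) := by
  have h1 : Tendsto (fun N => l + gridLocalTime X N (gridIndex N t) ω) atTop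
      (𝓝[Set.Ici 0] (l + localTime X t ω)) :=
    tendsto_nhdsWithin_iff.2 ⟨(hX.tendsto_gridLocalTime ω ht).const_add l,
      Eventually.of_forall fun N => add_nonneg hl (gridLocalTime_nonneg X N _ ω)⟩
  have h2 := ((hf (X t ω)) _ (add_nonneg hl (localTime_nonneg X ht ω))).tendsto.comp h1
  refine h2.congr' ?_
  filter_upwards [hX.eventually_grid_eq ω ht] with N hN
  simp [hN]

lemma IsMarkovChain.integrable_observable_and_tendsto (hX : IsMarkovChain Q X ℙ)
    (hQ : IsGenerator Q) (hf : ∀ j, ContinuousOn (f j) (Set.Ici 0)) (hfd : RapidDecay f)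
    (i : Fin n) {l : Fin n → ℝ} (hl : 0 ≤ l) {t : ℝ} (ht : 0 ≤ t) :
    Integrable (observable X f l t) (ℙ i) ∧
      Tendsto (fun N => gridExpect Q f N (gridIndex N t) i l) atTop (𝓝 (expect X ℙ f i l t)) := by
  have := hX.isProbabilityMeasure i
  obtain ⟨C, hC, hb⟩ := hfd 0
  have hb' : ∀ j l, 0 ≤ l → ‖f j l‖ ≤ C := fun j l hl => by simpa using hb j l hl
  have hm := fun N => (hX.measurable_gridObservable f l N (gridIndex N t)).aestronglyMeasurable
    (μ := ℙ i)
  have hlim := hX.tendsto_gridObservable hf hl ht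
  constructor
  · refine Integrable.of_bound (aestronglyMeasurable_of_tendsto_ae atTop hm (ae_of_all _ hlim)) C
      (ae_of_all _ fun ω => hb' _ _ (add_nonneg hl (localTime_nonneg X ht ω)))
  · simp only [hX.gridExpect_eq_integral hQ]
    exact tendsto_integral_of_dominated_convergence (fun _ => C) hm (integrable_const C)
      (fun N => ae_of_all _ fun ω => hb' _ _ (add_nonneg hl (gridLocalTime_nonneg X N _ ω)))
      (ae_of_all _ hlim)

lemma IsMarkovChain.potentialConverges_and_tendsto (hX : IsMarkovChain Q X ℙ)
    (hQ : IsGenerator Q) (hf : ∀ j, ContinuousOn (f j) (Set.Ici 0)) (hfd : RapidDecay f)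
    (i : Fin n) {l : Fin n → ℝ} (hl : 0 ≤ l) :
    IntegrableOn (expect X ℙ f i l) (Set.Ioi 0) ∧
      Tendsto (fun N => gridPotential Q f N i l) atTop (𝓝 (potential X ℙ f i l)) := by
  obtain ⟨C, hC, hb⟩ := hfd 2
  have hw := one_le_weight hl
  have hB : IntegrableOn (fun s : ℝ => C * (1 + ‖s‖) ^ (-(2 : ℝ))) (Set.Ioi 0) :=
    ((integrable_one_add_norm (by simp)).const_mul C).integrableOn
  have hle : ∀ N, ∀ s ∈ Set.Ioi (0 : ℝ),
      ‖gridExpect Q f N (gridIndex N s) i l‖ ≤ C * (1 + ‖s‖) ^ (-(2 : ℝ)) := fun N s hs => by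
    refine (norm_gridExpect_le hQ hb N _ i hl).trans ?_
    have hs' : (0 : ℝ) < s := hs
    rw [Real.rpow_neg (by positivity), ← div_eq_mul_inv, Real.norm_of_nonneg hs'.le,
      Real.rpow_two]
    have := lt_gridIndex_mul_mesh N s
    gcongr
  have hm : ∀ N, Measurable fun s => gridExpect Q f N (gridIndex N s) i l := fun N =>
    (measurable_of_countable fun k => gridExpect Q f N k i l).comp (measurable_gridIndex N)
  have hlim : ∀ s ∈ Set.Ioi (0 : ℝ), Tendsto (fun N => gridExpect Q f N (gridIndex N s) i l) atTop
      (𝓝 (expect X ℙ f i l s)) := fun s hs =>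
    (hX.integrable_observable_and_tendsto hQ hf hfd i hl (le_of_lt hs)).2
  constructor
  · refine hB.mono' (aestronglyMeasurable_of_tendsto_ae atTop
      (fun N => (hm N).aestronglyMeasurable)
      ((ae_restrict_iff' measurableSet_Ioi).2 (ae_of_all _ hlim)))
      ((ae_restrict_iff' measurableSet_Ioi).2 (ae_of_all _ fun s hs => ?_))
    exact le_of_tendsto (hlim s hs).norm (Eventually.of_forall fun N => hle N s hs)
  -- The (N+1)² terms cover the time interval up to `N + 1`; the cutoff puts all sums on one
  -- half-line, where C(1+s)⁻² dominates.
  · have heq : ∀ N, gridPotential Q f N i l = ∫ s in Set.Ioi (0 : ℝ),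
        (Set.Iic ((N : ℝ) + 1)).indicator (fun s => gridExpect Q f N (gridIndex N s) i l) s :=
      fun N => by
        have h1 : (((N + 1) ^ 2 : ℕ) : ℝ) * mesh N = (N : ℝ) + 1 := by
          rw [mesh]; push_cast; field_simp
        have h2 := (integral_comp_gridIndex (fun k => gridExpect Q f N k i l) N ((N + 1) ^ 2)).2
        rw [h1, intervalIntegral.integral_of_le (by positivity)] at h2
        rw [setIntegral_indicator measurableSet_Iic, Set.Ioi_inter_Iic, h2]
        simp [gridPotential]
    simp only [heq]
    refine tendsto_integral_of_dominated_convergence _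
      (fun N => ((hm N).indicator measurableSet_Iic).aestronglyMeasurable) hB
      (fun N => (ae_restrict_iff' measurableSet_Ioi).2 (ae_of_all _ fun s hs =>
        (norm_indicator_le_norm_self _ _).trans (hle N s hs)))
      ((ae_restrict_iff' measurableSet_Ioi).2 (ae_of_all _ fun s hs => ?_))
    refine (hlim s hs).congr' ?_
    filter_upwards [eventually_ge_atTop ⌈s⌉₊] with N hN
    rw [Set.indicator_of_mem]
    have : (⌈s⌉₊ : ℝ) ≤ N := by exact_mod_cast hN
    exact Set.mem_Iic.2 (by linarith [Nat.le_ceil s])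

end Chain

/-! ### Derivatives on the orthant -/

lemma weight_le (l : Fin n → ℝ) : weight l ≤ (n + 1) * (1 + ‖l‖) := by
  have h1 : ∑ j, l j ≤ ∑ _j : Fin n, ‖l‖ := Finset.sum_le_sum fun j _ =>
    (le_abs_self (l j)).trans (norm_le_pi_norm l j)
  simp only [Finset.sum_const, Finset.card_univ, Fintype.card_fin, nsmul_eq_mul] at h1
  have h2 : (0 : ℝ) ≤ n := by positivity
  unfold weight
  nlinarith [norm_nonneg l]

lemma rapidDecay_of_norm {ι : Type*} [Fintype ι] {F : ι → (Fin n → ℝ) → ℂ}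
    (hF : ∀ j, ∀ d : ℕ, ∃ C : ℝ, ∀ l, 0 ≤ l → (1 + ‖l‖) ^ d * ‖F j l‖ ≤ C) : RapidDecay F := by
  intro d
  choose C hC using fun j => hF j d
  refine ⟨(n + 1) ^ d * ∑ j, |C j|, by positivity, fun j l hl => ?_⟩
  have hw := one_le_weight hl
  rw [le_div_iff₀ (by positivity)]
  calc ‖F j l‖ * weight l ^ d ≤ ‖F j l‖ * ((n + 1) * (1 + ‖l‖)) ^ d := by
        gcongr; exact weight_le l
    _ = (n + 1) ^ d * ((1 + ‖l‖) ^ d * ‖F j l‖) := by rw [mul_pow]; ring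
    _ ≤ _ := by
        gcongr
        exact ((hC j l hl).trans (le_abs_self _)).trans
          (Finset.single_le_sum (f := fun j => |C j|) (fun _ _ => abs_nonneg _)
            (Finset.mem_univ j))

lemma uniqueDiffOn_orthant : UniqueDiffOn ℝ (Set.Ici (0 : Fin n → ℝ)) := by
  rw [← Set.pi_univ_Ici]
  exact UniqueDiffOn.univ_pi fun _ => uniqueDiffOn_Ici _

lemma hasPartial_of_differentiableOn {F : (Fin n → ℝ) → ℂ}
    (hF : DifferentiableOn ℝ F (Set.Ici 0)) (m : Fin n) :
    HasPartial m F fun l => fderivWithin ℝ F (Set.Ici 0) l (Pi.single m 1) := by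
  intro l hl
  have h1 : HasDerivAt (fun s : ℝ => l + (Pi.single m s : Fin n → ℝ)) (Pi.single m 1) 0 := by
    have := (ContinuousLinearMap.single ℝ (fun _ : Fin n => ℝ) m).hasDerivAt (x := (0 : ℝ))
    exact this.const_add l
  have h2 : HasFDerivWithinAt F (fderivWithin ℝ F (Set.Ici 0) l) (Set.Ici 0)
      (l + (Pi.single m (0 : ℝ) : Fin n → ℝ)) := by
    simpa using (hF l hl).hasFDerivWithinAt
  exact h2.comp_hasDerivWithinAt (0 : ℝ) h1.hasDerivWithinAt fun s hs => add_single_nonneg hl m hs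

lemma exists_smoothFamily {f : Fin n → (Fin n → ℝ) → ℂ} (hf : ∀ i, PropertyF (f i)) :
    ∃ D D₂, SmoothFamily f D D₂ := by
  set O : Set (Fin n → ℝ) := Set.Ici 0 with hO
  have hu : UniqueDiffOn ℝ O := uniqueDiffOn_orthant
  have h1 : ∀ j, ContDiffOn ℝ 1 (fun l => fderivWithin ℝ (f j) O l) O := fun j =>
    ((hf j).1.fderivWithin hu (m := (⊤ : ℕ∞)) (by simp)).of_le (by simp)
  have h1' : ∀ m j, ContDiffOn ℝ 1 (fun l => fderivWithin ℝ (f j) O l (Pi.single m 1)) O :=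
    fun m j => (h1 j).clm_apply contDiffOn_const
  have hs : ∀ m : Fin n, ‖(Pi.single m 1 : Fin n → ℝ)‖ ≤ 1 := fun m =>
    (pi_norm_le_iff_of_nonneg zero_le_one).2 fun k => by
      rw [Pi.single_apply]; split_ifs <;> simp
  have hd : ∀ j k d, ∃ C : ℝ, ∀ l, 0 ≤ l →
      (1 + ‖l‖) ^ d * ‖iteratedFDerivWithin ℝ k (f j) O l‖ ≤ C := fun j k d => (hf j).2 k d
  refine ⟨fun m j l => fderivWithin ℝ (f j) O l (Pi.single m 1),
    fun m j l => fderivWithin ℝ (fun l => fderivWithin ℝ (f j) O l (Pi.single m 1)) O l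
      (Pi.single m 1),
    fun m j => hasPartial_of_differentiableOn ((hf j).1.differentiableOn (by simp)) m,
    fun m j => hasPartial_of_differentiableOn ((h1' m j).differentiableOn (by simp)) m,
    fun j => (hf j).1.continuousOn, fun m j => (h1' m j).continuousOn,
    rapidDecay_of_norm fun j d => ?_, rapidDecay_of_norm fun x d => ?_,
    rapidDecay_of_norm fun x d => ?_⟩
  · obtain ⟨C, hC⟩ := hd j 0 d
    exact ⟨C, fun l hl => by simpa using hC l hl⟩
  · obtain ⟨C, hC⟩ := hd x.2 1 d
    refine ⟨C, fun l hl => le_trans ?_ (hC l hl)⟩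
    rw [norm_iteratedFDerivWithin_one _ (hu l hl)]
    gcongr
    exact ContinuousLinearMap.le_of_opNorm_le_of_le _ le_rfl (hs _) |>.trans (by simp)
  · obtain ⟨C, hC⟩ := hd x.2 2 d
    refine ⟨C, fun l hl => le_trans ?_ (hC l hl)⟩
    rw [← norm_iteratedFDerivWithin_fderivWithin hu hl,
      norm_iteratedFDerivWithin_one _ (hu l hl)]
    gcongr
    -- Evaluation at a fixed vector commutes with differentiation, so the pure second partial is a
    -- value of the second derivative.
    have h2 : fderivWithin ℝ (fun l => fderivWithin ℝ (f x.2) O l (Pi.single x.1 1)) O l =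
        (fderivWithin ℝ (fderivWithin ℝ (f x.2) O) O l).flip (Pi.single x.1 1) := by
      have := (((h1 x.2).differentiableOn (by simp) l hl).hasFDerivWithinAt.clm_apply
        (hasFDerivWithinAt_const (Pi.single x.1 1 : Fin n → ℝ) l O)).fderivWithin (hu l hl)
      simpa using this
    rw [h2, ContinuousLinearMap.flip_apply]
    refine (ContinuousLinearMap.le_opNorm₂ _ _ _).trans ?_
    have := hs x.1
    calc _ ≤ ‖fderivWithin ℝ (fderivWithin ℝ (f x.2) O) O l‖ * 1 * 1 := by gcongr
      _ = _ := by ring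

/-- The first Ward identity, for a general generator. -/
theorem ward_identity {Ω : Type*} [MeasurableSpace Ω] {Q : Matrix (Fin n) (Fin n) ℝ}
    {X : ℝ → Ω → Fin n} {ℙ : Fin n → Measure Ω} (hQ : IsGenerator Q) (hX : IsMarkovChain Q X ℙ)
    {f : Fin n → (Fin n → ℝ) → ℂ} (hf : ∀ i, PropertyF (f i))
    {g : (Fin n → ℂ) → ℂ} (hg : PropertyG g) :
    PotentialConverges X ℙ f ∧
      (∀ i, BracketIntegrable Q (fun φ => φ i * g φ * f i (absSq φ))) ∧
      (∀ i, BracketIntegrable Q (fun φ => wirtingerBar i g φ * potential X ℙ f i (absSq φ))) ∧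
      ∑ i, bracket Q (fun φ => φ i * g φ * f i (absSq φ)) =
        ∑ i, bracket Q (fun φ => wirtingerBar i g φ * potential X ℙ f i (absSq φ)) := by
  obtain ⟨D, D₂, hD⟩ := exists_smoothFamily hf
  refine ⟨fun i l hl => ⟨fun t ht =>
    (hX.integrable_observable_and_tendsto hQ hD.continuousOn hD.decay i hl ht).1,
    (hX.potentialConverges_and_tendsto hQ hD.continuousOn hD.decay i hl).1⟩, ?_⟩
  exact hD.ward_of_tendsto hQ hg fun i l hl =>
    (hX.potentialConverges_and_tendsto hQ hD.continuousOn hD.decay i hl).2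

/-! ### The second identity by complex conjugation -/

section Conjugation

/-- Complex conjugation of the coordinates. -/
def conjPi (n : ℕ) : (Fin n → ℂ) →L[ℝ] (Fin n → ℂ) :=
  ContinuousLinearMap.pi fun i => (Complex.conjCLE : ℂ →L[ℝ] ℂ).comp (ContinuousLinearMap.proj i)

@[simp] lemma conjPi_apply (φ : Fin n → ℂ) (i : Fin n) : conjPi n φ i = conj (φ i) := rfl

lemma conjPi_single (i : Fin n) (c : ℂ) : conjPi n (Pi.single i c) = Pi.single i (conj c) := by
  ext k
  by_cases hk : k = i
  · subst hk; simp
  · simp [hk]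

@[simp] lemma absSq_conjPi (φ : Fin n → ℂ) : absSq (conjPi n φ) = absSq φ := by
  ext i; simp [absSq]

lemma density_conjPi (Q : Matrix (Fin n) (Fin n) ℝ) (φ : Fin n → ℂ) :
    density Q (conjPi n φ) = density Q.transpose φ := by
  unfold density
  congr 2
  rw [Finset.sum_comm]
  refine Finset.sum_congr rfl fun i _ => Finset.sum_congr rfl fun j _ => ?_
  simp only [conjPi_apply, Complex.conj_conj, Matrix.transpose_apply]
  ring

lemma measurePreserving_conjPi : MeasurePreserving (conjPi n) volume volume :=
  volume_preserving_pi fun _ => Complex.conjLIE.measurePreserving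

lemma measurableEmbedding_conjPi : MeasurableEmbedding (conjPi n) := by
  have hinv : ∀ φ, conjPi n (conjPi n φ) = φ := fun φ => by ext i; simp
  exact (Homeomorph.mk ⟨conjPi n, conjPi n, hinv, hinv⟩ (conjPi n).continuous
    (conjPi n).continuous).measurableEmbedding

lemma bracket_conjPi (Q : Matrix (Fin n) (Fin n) ℝ) (F : (Fin n → ℂ) → ℂ) :
    bracket Q.transpose (fun φ => F (conjPi n φ)) = bracket Q F := by
  unfold bracket
  simp only [← density_conjPi]
  exact measurePreserving_conjPi.integral_comp measurableEmbedding_conjPi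
    (fun φ => F φ * density Q φ)

lemma bracketIntegrable_conjPi (Q : Matrix (Fin n) (Fin n) ℝ) (F : (Fin n → ℂ) → ℂ) :
    BracketIntegrable Q.transpose (fun φ => F (conjPi n φ)) ↔ BracketIntegrable Q F := by
  unfold BracketIntegrable
  simp only [← density_conjPi]
  exact measurePreserving_conjPi.integrable_comp_emb measurableEmbedding_conjPi
    (g := fun φ => F φ * density Q φ)

/-- Conjugation fixes the real direction e_i and reverses I·e_i, which flips the sign between the
two Wirtinger operators. -/
lemma wirtingerBar_comp_conjPi {g : (Fin n → ℂ) → ℂ} (hg : Differentiable ℝ g) (i : Fin n)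
    (φ : Fin n → ℂ) :
    wirtingerBar i (fun φ => g (conjPi n φ)) φ = wirtinger i g (conjPi n φ) := by
  have h : fderiv ℝ (fun φ => g (conjPi n φ)) φ =
      (fderiv ℝ g (conjPi n φ)).comp (conjPi n) :=
    ((hg _).hasFDerivAt.comp φ (conjPi n).hasFDerivAt).fderiv
  have hI : (Pi.single i (-Complex.I) : Fin n → ℂ) = -Pi.single i Complex.I := Pi.single_neg _ _
  simp only [wirtingerBar, wirtinger, h, ContinuousLinearMap.comp_apply, conjPi_single, map_one,
    Complex.conj_I, hI, map_neg]
  ring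

end Conjugation

/-- The second Ward identity, for a general generator. -/
theorem ward_identity_conj {Ω : Type*} [MeasurableSpace Ω] {Q : Matrix (Fin n) (Fin n) ℝ}
    {X : ℝ → Ω → Fin n} {ℙ : Fin n → Measure Ω} (hQ : IsGenerator Q)
    (hX : IsMarkovChain Q.transpose X ℙ)
    {f : Fin n → (Fin n → ℝ) → ℂ} (hf : ∀ i, PropertyF (f i))
    {g : (Fin n → ℂ) → ℂ} (hg : PropertyG g) :
    PotentialConverges X ℙ f ∧
      (∀ i, BracketIntegrable Q (fun φ => conj (φ i) * g φ * f i (absSq φ))) ∧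
      (∀ i, BracketIntegrable Q (fun φ => wirtinger i g φ * potential X ℙ f i (absSq φ))) ∧
      ∑ i, bracket Q (fun φ => conj (φ i) * g φ * f i (absSq φ)) =
        ∑ i, bracket Q (fun φ => wirtinger i g φ * potential X ℙ f i (absSq φ)) := by
  have hg' : PropertyG (fun φ => g (conjPi n φ)) :=
    Function.HasTemperateGrowth.comp hg (conjPi n).hasTemperateGrowth
  have hdiff : Differentiable ℝ g := hg.1.differentiable (by simp)
  -- The first identity for the transposed generator and g∘conj; φφ̄ is unchanged by conjugation, so
  -- `f` and its potential stay the same.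
  have key := ward_identity hQ.transpose hX hf hg'
  simp only [wirtingerBar_comp_conjPi hdiff] at key
  simp only [← bracket_conjPi Q, ← bracketIntegrable_conjPi Q, conjPi_apply, absSq_conjPi,
    Complex.conj_conj]
  exact key

end Ward

end

theorem lemma3p2 {n : ℕ} (P : Matrix (Fin n) (Fin n) ℝ) (st : Fin n → ℝ)
    (hP : P ∈ Matrix.rowStochastic ℝ (Fin n)) (hirr : P.IsIrreducible)
    (hst : Ward.IsStationary P st)
    {Ω : Type*} [MeasurableSpace Ω] (X : ℝ → Ω → Fin n) (ℙ : Fin n → Measure Ω)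
    (hX : Ward.IsMarkovChain (Ward.laplacian P st) X ℙ)
    {Ω' : Type*} [MeasurableSpace Ω'] (X' : ℝ → Ω' → Fin n) (ℙ' : Fin n → Measure Ω')
    (hX' : Ward.IsMarkovChain (Ward.laplacian (Ward.timeReversal P st) st) X' ℙ')
    (f : Fin n → (Fin n → ℝ) → ℂ) (hf : ∀ i, Ward.PropertyF (f i))
    (g : (Fin n → ℂ) → ℂ) (hg : Ward.PropertyG g) :
    (Ward.PotentialConverges X ℙ f ∧
      (∀ i, Ward.BracketIntegrable (Ward.laplacian P st)
        (fun φ => φ i * g φ * f i (Ward.absSq φ))) ∧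
      (∀ i, Ward.BracketIntegrable (Ward.laplacian P st)
        (fun φ => Ward.wirtingerBar i g φ * Ward.potential X ℙ f i (Ward.absSq φ))) ∧
      ∑ i, Ward.bracket (Ward.laplacian P st)
          (fun φ => φ i * g φ * f i (Ward.absSq φ)) =
        ∑ i, Ward.bracket (Ward.laplacian P st)
          (fun φ => Ward.wirtingerBar i g φ * Ward.potential X ℙ f i (Ward.absSq φ))) ∧
    (Ward.PotentialConverges X' ℙ' f ∧
      (∀ i, Ward.BracketIntegrable (Ward.laplacian P st)
        (fun φ => (starRingEnd ℂ) (φ i) * g φ * f i (Ward.absSq φ))) ∧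
      (∀ i, Ward.BracketIntegrable (Ward.laplacian P st)
        (fun φ => Ward.wirtinger i g φ * Ward.potential X' ℙ' f i (Ward.absSq φ))) ∧
      ∑ i, Ward.bracket (Ward.laplacian P st)
          (fun φ => (starRingEnd ℂ) (φ i) * g φ * f i (Ward.absSq φ)) =
        ∑ i, Ward.bracket (Ward.laplacian P st)
          (fun φ => Ward.wirtinger i g φ * Ward.potential X' ℙ' f i (Ward.absSq φ))) := by
  have hQ := Ward.IsGenerator.laplacian hP hst
  rw [Ward.laplacian_timeReversal hP hst] at hX'
  exact ⟨Ward.ward_identity hQ hX hf hg, Ward.ward_identity_conj hQ hX' hf hg⟩
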